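/- Orthonormal bases $B_1,\dots,B_m$ of $\mathbb{C}^n$ are called mutually unbiased if $|\langle v,w\rangle| = 1/\sqrt{n}$ whenever $v\in B_i$, $w\in B_j$ and $i\neq j$, where $\langle\cdot,\cdot\rangle$ is the standard Hermitian inner product. For a Hermitian $p\times p$ matrix $A$ with eigenvalues $\lambda_1,\dots,\lambda_p$, counted with multiplicity, let $F_A(x)=\frac1p\#\{i:\lambda_i\le x\}$ be its empirical spectral distribution. Theorem. Let $y\in(0,1)$. For each $n$ in an infinite set of dimensions (or along any sequence of dimensions $n\to\infty$) such that $p:=yn$ is an integer, let $B_1,\dots,B_m$ be mutually unbiased bases of $\mathbb{C}^n$ with $m=m(n)\ge\sqrt n$. Choose $p$ vectors uniformly and independently from the disjoint union $\bigsqcup_{i=1}^m B_i$ (which has $mn$ elements), let $\Phi_n$ be the random $p\times n$ matrix with these vectors as rows, and let $\mathcal{G}_n=\Phi_n\Phi_n^*$ be its Gram matrix. Then for every $x\in\mathbb{R}$, as $n\to\infty$ with $y=p/n$ fixed, $$F_{\mathcal{G}_n}(x)\to F_{\mathrm{MP},y}(x)\quad\text{in probability},$$ that is, $\mathbb{P}\big(|F_{\mathcal{G}_n}(x)-F_{\mathrm{MP},y}(x)|\ge\varepsilon\big)\to0$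 for every $\varepsilon>0$. Here $F_{\mathrm{MP},y}$ is the cumulative distribution function of the Marchenko--Pastur law, the law with density $$f_{\mathrm{MP},y}(x)=\frac{1}{2\pi xy}\sqrt{(b-x)(x-a)}\;\mathbf{1}_{[a,b]}(x),\qquad a=(1-\sqrt y)^2,\quad b=(1+\sqrt y)^2.$$ -/

import Mathlib

open MeasureTheory ProbabilityTheory Filter Topology
open scoped ENNReal Matrix

noncomputable section

/-- `m` orthonormal bases of `ℂⁿ` (with its standard Hermitian inner product) are mutually
unbiased if vectors taken from two different bases have inner product of modulus `1 / √n`. -/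
def MutuallyUnbiased {m n : ℕ}
    (B : Fin m → OrthonormalBasis (Fin n) ℂ (EuclideanSpace ℂ (Fin n))) : Prop :=
  ∀ i j : Fin m, i ≠ j → ∀ a b : Fin n, ‖inner ℂ (B i a) (B j b)‖ = 1 / √(n : ℝ)

/-- A choice of `p` vectors from the disjoint union of `m` bases of `ℂⁿ`. The pair `(i, a)`
stands for the `a`-th vector of the `i`-th basis. -/
abbrev Selection (p m n : ℕ) : Type := Fin p → Fin m × Fin n

/-- The uniform probability on the set of all choices of `p` vectors, under which the `p` vectors
are independent and each is uniform on the disjoint union. -/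
def selectionMeasure (p m n : ℕ) : Measure (Selection p m n) :=
  uniformOn Set.univ

/-- The `p × n` matrix whose rows are the chosen vectors. -/
def rowMatrix {p m n : ℕ}
    (B : Fin m → OrthonormalBasis (Fin n) ℂ (EuclideanSpace ℂ (Fin n)))
    (s : Selection p m n) : Matrix (Fin p) (Fin n) ℂ :=
  Matrix.of fun i j => B (s i).1 (s i).2 j

/-- The spectral measure of a Hermitian `p × p` matrix: the average of the Dirac measures at its
eigenvalues, counted with multiplicity. -/
def spectralMeasure {p : ℕ} {A : Matrix (Fin p) (Fin p) ℂ} (hA : A.IsHermitian) : Measure ℝ :=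
  (p : ℝ≥0∞)⁻¹ • ∑ i : Fin p, Measure.dirac (hA.eigenvalues i)

/-- The empirical spectral distribution of a Hermitian matrix: the cumulative distribution
function of its spectral measure. -/
def empiricalSpectralDistribution {p : ℕ} {A : Matrix (Fin p) (Fin p) ℂ} (hA : A.IsHermitian)
    (x : ℝ) : ℝ :=
  (spectralMeasure hA).real (Set.Iic x)

/-- The empirical spectral distribution of the Gram matrix `Φ Φ*`. -/
def gramESD {p n : ℕ} (Φ : Matrix (Fin p) (Fin n) ℂ) (x : ℝ) : ℝ :=
  empiricalSpectralDistribution (Matrix.isHermitian_mul_conjTranspose_self Φ) x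

/-- The Marchenko-Pastur density with parameter `y`. -/
def marchenkoPasturDensity (y x : ℝ) : ℝ :=
  Set.indicator (Set.Icc ((1 - √y) ^ 2) ((1 + √y) ^ 2))
    (fun t => 1 / (2 * Real.pi * t * y) *
      √(((1 + √y) ^ 2 - t) * (t - (1 - √y) ^ 2))) x

/-- The Marchenko-Pastur law with parameter `y`. -/
def marchenkoPasturLaw (y : ℝ) : Measure ℝ :=
  volume.withDensity fun x => ENNReal.ofReal (marchenkoPasturDensity y x)

/-- The cumulative distribution function of the Marchenko-Pastur law with parameter `y`. -/
def marchenkoPasturCDF (y x : ℝ) : ℝ :=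
  (marchenkoPasturLaw y).real (Set.Iic x)

end

/-! ### Resolvents at negative real points and rank-one perturbations -/

section ShiftedInverse

open scoped ComplexOrder

set_option linter.unusedSectionVars false

variable {ι : Type*} [Fintype ι] [DecidableEq ι]

/-! Write Φ*Φ = ∑ vₖvₖ*, with vₖ the conjugated rows, and R = (Φ*Φ + t)⁻¹ for t > 0. Rank-one
updates give n = t tr R + ∑ qₖ/(1 + qₖ), where qₖ = vₖ*R⁽ᵏ⁾vₖ and R⁽ᵏ⁾ omits vₖ
(`card_eq_trace_add_sum`). If every qₖ were s = tr R / n, then s would solve ts + ys/(1 + s) = 1,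
the equation satisfied by the companion Marchenko–Pastur transform; the equation is stable, so an
approximate solution is close to the exact one.

Unbiasedness makes qₖ concentrate. The matrices vv* − 1/n from different bases are Hilbert–Schmidt
orthogonal, so Bessel bounds the sum of squared deviations of v*Av from tr A / n over all mn vectors
by ‖A‖² (`sum_quadraticDeviation_sq_le`). As R⁽ᵏ⁾ is independent of vₖ and ‖R⁽ᵏ⁾‖² ≤ n/t², the mean
square deviation is at most 1/(mt²), which vanishes as m → ∞. Replacing tr R⁽ᵏ⁾ by tr R costs at
most 1/t.

Hence the Stieltjes transforms converge in mean on the negative half-line. Difference quotients in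
t, Weierstrass approximation in (x + 1)⁻¹ and a sandwich of the indicator transfer this to
distribution functions (`meanConverges_indicator_Iic`), and Markov's inequality concludes. -/

/-- The resolvent `(K + t)⁻¹` of a matrix at the real point `-t`. -/
noncomputable def shiftedInverse (K : Matrix ι ι ℂ) (t : ℝ) : Matrix ι ι ℂ :=
  (K + (t : ℂ) • (1 : Matrix ι ι ℂ))⁻¹

theorem Matrix.PosSemidef.add_smul_one_posDef {K : Matrix ι ι ℂ} (hK : K.PosSemidef) {t : ℝ}
    (ht : 0 < t) : (K + (t : ℂ) • (1 : Matrix ι ι ℂ)).PosDef :=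
  Matrix.PosDef.posSemidef_add hK (Matrix.PosDef.one.smul (by exact_mod_cast ht))

theorem add_smul_one_mul_shiftedInverse {K : Matrix ι ι ℂ} (hK : K.PosSemidef) {t : ℝ}
    (ht : 0 < t) : (K + (t : ℂ) • (1 : Matrix ι ι ℂ)) * shiftedInverse K t = 1 :=
  Matrix.mul_nonsing_inv _ ((Matrix.isUnit_iff_isUnit_det _).1 (hK.add_smul_one_posDef ht).isUnit)

theorem shiftedInverse_mul_add_smul_one {K : Matrix ι ι ℂ} (hK : K.PosSemidef) {t : ℝ}
    (ht : 0 < t) : shiftedInverse K t * (K + (t : ℂ) • (1 : Matrix ι ι ℂ)) = 1 :=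
  Matrix.nonsing_inv_mul _ ((Matrix.isUnit_iff_isUnit_det _).1 (hK.add_smul_one_posDef ht).isUnit)

theorem shiftedInverse_posDef {K : Matrix ι ι ℂ} (hK : K.PosSemidef) {t : ℝ}
    (ht : 0 < t) : (shiftedInverse K t).PosDef :=
  (hK.add_smul_one_posDef ht).inv

theorem star_dotProduct_self_eq_sum_norm_sq (w : ι → ℂ) :
    star w ⬝ᵥ w = ((∑ i, ‖w i‖ ^ 2 : ℝ) : ℂ) := by
  simp [dotProduct, ← Complex.normSq_eq_norm_sq, Complex.normSq_eq_conj_mul_self]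

theorem mul_sum_norm_sq_le_quadraticForm {K : Matrix ι ι ℂ} (hK : K.PosSemidef) (t : ℝ)
    (w : ι → ℂ) :
    t * ∑ i, ‖w i‖ ^ 2 ≤ (star w ⬝ᵥ (K + (t : ℂ) • (1 : Matrix ι ι ℂ)) *ᵥ w).re := by
  have h := (Complex.le_def.1 (hK.dotProduct_mulVec_nonneg w)).1
  rw [Matrix.add_mulVec, dotProduct_add, Matrix.smul_mulVec, Matrix.one_mulVec, dotProduct_smul,
    star_dotProduct_self_eq_sum_norm_sq, smul_eq_mul, ← Complex.ofReal_mul, Complex.add_re,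
    Complex.ofReal_re]
  simpa using h

/-- Coercivity of K + t tested at w = Ru; as an operator inequality, tR² ≤ R. Both the Frobenius
bound and the trace perturbation bound rest on it. -/
theorem mul_sum_norm_sq_shiftedInverse_mulVec_le {K : Matrix ι ι ℂ} (hK : K.PosSemidef) {t : ℝ}
    (ht : 0 < t) (u : ι → ℂ) :
    t * ∑ i, ‖(shiftedInverse K t *ᵥ u) i‖ ^ 2 ≤ (star u ⬝ᵥ shiftedInverse K t *ᵥ u).re := by
  have h := mul_sum_norm_sq_le_quadraticForm hK t (shiftedInverse K t *ᵥ u)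
  rw [Matrix.mulVec_mulVec, add_smul_one_mul_shiftedInverse hK ht, Matrix.one_mulVec] at h
  refine h.trans_eq ?_
  rw [← Complex.conj_re]
  congr 1
  rw [Matrix.star_dotProduct, ← starRingEnd_apply, Complex.conj_conj]

theorem quadraticForm_shiftedInverse_eq_re {K : Matrix ι ι ℂ} (hK : K.PosSemidef) {t : ℝ}
    (ht : 0 < t) (u : ι → ℂ) :
    star u ⬝ᵥ shiftedInverse K t *ᵥ u = ((star u ⬝ᵥ shiftedInverse K t *ᵥ u).re : ℂ) := by
  have h := (Complex.le_def.1
    ((shiftedInverse_posDef hK ht).posSemidef.dotProduct_mulVec_nonneg u)).2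
  exact Complex.ext rfl (by simpa using h.symm)

theorem quadraticForm_shiftedInverse_nonneg {K : Matrix ι ι ℂ} (hK : K.PosSemidef) {t : ℝ}
    (ht : 0 < t) (u : ι → ℂ) : 0 ≤ (star u ⬝ᵥ shiftedInverse K t *ᵥ u).re :=
  (Complex.le_def.1 ((shiftedInverse_posDef hK ht).posSemidef.dotProduct_mulVec_nonneg u)).1

theorem trace_shiftedInverse_nonneg {K : Matrix ι ι ℂ} (hK : K.PosSemidef) {t : ℝ}
    (ht : 0 < t) : 0 ≤ (shiftedInverse K t).trace.re :=
  (Complex.le_def.1 (shiftedInverse_posDef hK ht).posSemidef.trace_nonneg).1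

/-- Each column Reⱼ satisfies t‖Reⱼ‖² ≤ Rⱼⱼ ≤ ‖Reⱼ‖, so its norm is at most 1/t. -/
theorem sum_norm_sq_shiftedInverse_le {K : Matrix ι ι ℂ} (hK : K.PosSemidef) {t : ℝ}
    (ht : 0 < t) :
    ∑ i, ∑ j, ‖shiftedInverse K t i j‖ ^ 2 ≤ Fintype.card ι / t ^ 2 := by
  rw [Finset.sum_comm]
  have key : ∀ j, ∑ i, ‖shiftedInverse K t i j‖ ^ 2 ≤ 1 / t ^ 2 := by
    intro j
    have h := mul_sum_norm_sq_shiftedInverse_mulVec_le hK ht (Pi.single j 1)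
    simp only [Matrix.mulVec_single_one, Matrix.col_apply, ← Pi.single_star, star_one,
      single_one_dotProduct] at h
    have h1 : ‖shiftedInverse K t j j‖ ^ 2 ≤ ∑ i, ‖shiftedInverse K t i j‖ ^ 2 :=
      Finset.single_le_sum (f := fun i => ‖shiftedInverse K t i j‖ ^ 2)
        (fun i _ => by positivity) (Finset.mem_univ j)
    have h2 := h.trans (Complex.re_le_norm _)
    set r := ‖shiftedInverse K t j j‖
    set N := ∑ i, ‖shiftedInverse K t i j‖ ^ 2
    have hr : 0 ≤ r := norm_nonneg _
    have h3 : t * r ≤ 1 := by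
      rcases hr.eq_or_lt with h0 | h0
      · simp [← h0]
      · nlinarith
    rw [le_div_iff₀ (by positivity)]
    nlinarith
  calc _ ≤ ∑ _j : ι, 1 / t ^ 2 := Finset.sum_le_sum fun j _ => key j
    _ = _ := by simp [div_eq_mul_inv]

section RankOne

variable {K : Matrix ι ι ℂ} (hK : K.PosSemidef) {t : ℝ} (ht : 0 < t) (v : ι → ℂ)
include hK ht

theorem one_add_quadraticForm_ne_zero : (1 + star v ⬝ᵥ shiftedInverse K t *ᵥ v) ≠ 0 := by
  rw [quadraticForm_shiftedInverse_eq_re hK ht]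
  have := quadraticForm_shiftedInverse_nonneg hK ht v
  norm_cast
  positivity

/-- Sherman–Morrison applied to v: the perturbed matrix sends Rv to (1 + v*Rv)v. -/
theorem shiftedInverse_add_vecMulVec_mulVec :
    shiftedInverse (K + Matrix.vecMulVec v (star v)) t *ᵥ v =
      (1 + star v ⬝ᵥ shiftedInverse K t *ᵥ v)⁻¹ • (shiftedInverse K t *ᵥ v) := by
  have hK' : (K + Matrix.vecMulVec v (star v)).PosSemidef :=
    hK.add (Matrix.posSemidef_vecMulVec_self_star v)
  have h1 := add_smul_one_mul_shiftedInverse hK ht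
  have h2 := shiftedInverse_mul_add_smul_one hK' ht
  have h3 : (K + Matrix.vecMulVec v (star v) + (t : ℂ) • (1 : Matrix ι ι ℂ)) *ᵥ
      (shiftedInverse K t *ᵥ v) = (1 + star v ⬝ᵥ shiftedInverse K t *ᵥ v) • v := by
    rw [add_right_comm, Matrix.add_mulVec, Matrix.mulVec_mulVec, h1, Matrix.one_mulVec,
      Matrix.vecMulVec_mulVec, op_smul_eq_smul, add_smul, one_smul]
  have h4 := congrArg (fun w => shiftedInverse (K + Matrix.vecMulVec v (star v)) t *ᵥ w) h3
  simp only [Matrix.mulVec_mulVec, ← mul_assoc, h2, one_mul, Matrix.mulVec_smul] at h4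
  exact (eq_inv_smul_iff₀ (one_add_quadraticForm_ne_zero hK ht v)).2 h4.symm

theorem quadraticForm_shiftedInverse_add_vecMulVec :
    star v ⬝ᵥ shiftedInverse (K + Matrix.vecMulVec v (star v)) t *ᵥ v =
      (((star v ⬝ᵥ shiftedInverse K t *ᵥ v).re /
        (1 + (star v ⬝ᵥ shiftedInverse K t *ᵥ v).re) : ℝ) : ℂ) := by
  rw [shiftedInverse_add_vecMulVec_mulVec hK ht, dotProduct_smul, smul_eq_mul,
    quadraticForm_shiftedInverse_eq_re hK ht]
  push_cast
  rw [div_eq_inv_mul]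
  simp

/-- By the resolvent identity the trace drops by ‖Rv‖²/(1 + q) with q = v*Rv, and t‖Rv‖² ≤ q makes
this at most 1/t, whatever the size of v. -/
theorem trace_shiftedInverse_sub_trace_add_vecMulVec :
    |(shiftedInverse (K + Matrix.vecMulVec v (star v)) t).trace.re
      - (shiftedInverse K t).trace.re| ≤ 1 / t := by
  have hK' : (K + Matrix.vecMulVec v (star v)).PosSemidef :=
    hK.add (Matrix.posSemidef_vecMulVec_self_star v)
  have h1 := add_smul_one_mul_shiftedInverse hK ht
  have h2 := shiftedInverse_mul_add_smul_one hK' ht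
  have hdiff : shiftedInverse K t - shiftedInverse (K + Matrix.vecMulVec v (star v)) t =
      shiftedInverse (K + Matrix.vecMulVec v (star v)) t * Matrix.vecMulVec v (star v) *
        shiftedInverse K t := by
    set R' := shiftedInverse (K + Matrix.vecMulVec v (star v)) t
    have e : Matrix.vecMulVec v (star v) =
      (K + Matrix.vecMulVec v (star v) + (t : ℂ) • (1 : Matrix ι ι ℂ)) -
        (K + (t : ℂ) • (1 : Matrix ι ι ℂ)) := by abel
    rw [e, mul_sub, h2, sub_mul, one_mul, mul_assoc, h1, mul_one]
  have hherm : star v ᵥ* shiftedInverse K t = star (shiftedInverse K t *ᵥ v) := by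
    rw [Matrix.star_mulVec, (shiftedInverse_posDef hK ht).1.eq]
  have htr : (shiftedInverse K t).trace
      - (shiftedInverse (K + Matrix.vecMulVec v (star v)) t).trace =
      (((1 + (star v ⬝ᵥ shiftedInverse K t *ᵥ v).re)⁻¹ *
        ∑ i, ‖(shiftedInverse K t *ᵥ v) i‖ ^ 2 : ℝ) : ℂ) := by
    rw [← Matrix.trace_sub, hdiff, Matrix.mul_vecMulVec, Matrix.vecMulVec_mul,
      Matrix.trace_vecMulVec, hherm, shiftedInverse_add_vecMulVec_mulVec hK ht, dotProduct_comm,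
      dotProduct_smul, star_dotProduct_self_eq_sum_norm_sq, quadraticForm_shiftedInverse_eq_re hK ht]
    simp
  have hre := congrArg Complex.re htr
  rw [Complex.sub_re, Complex.ofReal_re] at hre
  have hq := quadraticForm_shiftedInverse_nonneg hK ht v
  have hb := mul_sum_norm_sq_shiftedInverse_mulVec_le hK ht v
  set q := (star v ⬝ᵥ shiftedInverse K t *ᵥ v).re
  have hN : 0 ≤ ∑ i, ‖(shiftedInverse K t *ᵥ v) i‖ ^ 2 := by positivity
  set N := ∑ i, ‖(shiftedInverse K t *ᵥ v) i‖ ^ 2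
  rw [abs_sub_comm, hre, abs_of_nonneg (by positivity), inv_mul_eq_div,
    div_le_div_iff₀ (by positivity) ht]
  linarith

end RankOne

end ShiftedInverse

/-! ### The approximate Marchenko–Pastur equation and its stability -/

section OuterSum

open scoped ComplexOrder

set_option linter.unusedSectionVars false

variable {ι κ : Type*} [Fintype ι] [DecidableEq ι] [DecidableEq κ]

/-- The sum of the rank-one matrices `v v*` over a finite family of vectors. -/
def outerSum (J : Finset κ) (V : κ → ι → ℂ) : Matrix ι ι ℂ :=
  ∑ j ∈ J, Matrix.vecMulVec (V j) (star (V j))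

theorem outerSum_posSemidef (J : Finset κ) (V : κ → ι → ℂ) : (outerSum J V).PosSemidef :=
  Matrix.posSemidef_sum J fun j _ => Matrix.posSemidef_vecMulVec_self_star (V j)

theorem outerSum_erase_add (J : Finset κ) (V : κ → ι → ℂ) {k : κ} (hk : k ∈ J) :
    outerSum (J.erase k) V + Matrix.vecMulVec (V k) (star (V k)) = outerSum J V :=
  Finset.sum_erase_add _ _ hk

theorem trace_outerSum_mul (J : Finset κ) (V : κ → ι → ℂ) (A : Matrix ι ι ℂ) :
    (outerSum J V * A).trace = ∑ j ∈ J, star (V j) ⬝ᵥ A *ᵥ V j := by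
  rw [outerSum, Finset.sum_mul, Matrix.trace_sum]
  refine Finset.sum_congr rfl fun j _ => ?_
  rw [Matrix.trace_mul_comm, Matrix.mul_vecMulVec, Matrix.trace_vecMulVec, dotProduct_comm]

/-- The trace identity `card ι = t tr R + ∑ₖ qₖ / (1 + qₖ)` for the resolvent of a sum of rank-one
matrices. -/
theorem card_eq_trace_add_sum (J : Finset κ) (V : κ → ι → ℂ) {t : ℝ} (ht : 0 < t) :
    (Fintype.card ι : ℝ) = t * (shiftedInverse (outerSum J V) t).trace.re +
      ∑ k ∈ J, (star (V k) ⬝ᵥ shiftedInverse (outerSum (J.erase k) V) t *ᵥ V k).re /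
        (1 + (star (V k) ⬝ᵥ shiftedInverse (outerSum (J.erase k) V) t *ᵥ V k).re) := by
  have h := congrArg Matrix.trace
    (add_smul_one_mul_shiftedInverse (outerSum_posSemidef J V) ht)
  rw [add_mul, Matrix.trace_add, trace_outerSum_mul, Matrix.trace_one, smul_mul_assoc, one_mul,
    Matrix.trace_smul] at h
  have h2 := congrArg Complex.re h
  rw [Complex.add_re, Complex.re_sum, smul_eq_mul, Complex.re_ofReal_mul, Complex.natCast_re] at h2
  rw [← h2, add_comm]
  congr 1
  refine Finset.sum_congr rfl fun k hk => ?_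
  -- Removing the k-th term leaves a resolvent that does not involve vₖ, at the price of the map q ↦
  -- q/(1 + q).
  have := quadraticForm_shiftedInverse_add_vecMulVec (outerSum_posSemidef (J.erase k) V) ht (V k)
  rw [outerSum_erase_add J V hk] at this
  rw [this, Complex.ofReal_re]

theorem abs_div_one_add_sub_div_one_add_le {a b : ℝ} (ha : 0 ≤ a) (hb : 0 ≤ b) :
    |a / (1 + a) - b / (1 + b)| ≤ |a - b| := by
  have : a / (1 + a) - b / (1 + b) = (a - b) / ((1 + a) * (1 + b)) := by
    field_simp; ring
  rw [this, abs_div, abs_of_pos (by positivity : 0 < (1 + a) * (1 + b))]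
  exact div_le_self (abs_nonneg _) (by nlinarith)

/-- The normalized trace of a square complex matrix (its real part). -/
noncomputable def normalizedTrace (A : Matrix ι ι ℂ) : ℝ := A.trace.re / Fintype.card ι

/-- The deviation of the quadratic form at a vector from the normalized trace. -/
noncomputable def quadraticDeviation (A : Matrix ι ι ℂ) (v : ι → ℂ) : ℝ :=
  |(star v ⬝ᵥ A *ᵥ v).re - normalizedTrace A|

/-- The normalized trace of the resolvent approximately satisfies the Marchenko-Pastur equation. -/
theorem marchenkoPastur_equation_defect_le [Nonempty ι] (J : Finset κ) (V : κ → ι → ℂ) {t : ℝ}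
    (ht : 0 < t) :
    |1 - t * normalizedTrace (shiftedInverse (outerSum J V) t) -
      (J.card : ℝ) / Fintype.card ι * (normalizedTrace (shiftedInverse (outerSum J V) t) /
        (1 + normalizedTrace (shiftedInverse (outerSum J V) t)))| ≤
    (Fintype.card ι : ℝ)⁻¹ * ∑ k ∈ J,
      (quadraticDeviation (shiftedInverse (outerSum (J.erase k) V) t) (V k)
        + 1 / (t * Fintype.card ι)) := by
  have hN : (0 : ℝ) < Fintype.card ι := by exact_mod_cast Fintype.card_pos
  set N := (Fintype.card ι : ℝ)
  have h := card_eq_trace_add_sum J V ht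
  set s := normalizedTrace (shiftedInverse (outerSum J V) t) with hs
  have hs0 : 0 ≤ s := div_nonneg (trace_shiftedInverse_nonneg (outerSum_posSemidef J V) ht) hN.le
  have htr : (shiftedInverse (outerSum J V) t).trace.re = N * s := by
    rw [hs, normalizedTrace, mul_div_cancel₀ _ hN.ne']
  rw [htr] at h
  change N = _ at h
  have e : 1 - t * s - (J.card : ℝ) / N * (s / (1 + s)) = N⁻¹ * ∑ k ∈ J,
      ((star (V k) ⬝ᵥ shiftedInverse (outerSum (J.erase k) V) t *ᵥ V k).re /
        (1 + (star (V k) ⬝ᵥ shiftedInverse (outerSum (J.erase k) V) t *ᵥ V k).re)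
          - s / (1 + s)) := by
    rw [Finset.sum_sub_distrib, Finset.sum_const, nsmul_eq_mul, eq_sub_of_add_eq' h.symm]
    field_simp
  rw [e, abs_mul, abs_of_pos (inv_pos.2 hN)]
  refine mul_le_mul_of_nonneg_left ?_ (inv_pos.2 hN).le
  refine (Finset.abs_sum_le_sum_abs _ _).trans (Finset.sum_le_sum fun k hk => ?_)
  refine (abs_div_one_add_sub_div_one_add_le
    (quadraticForm_shiftedInverse_nonneg (outerSum_posSemidef _ V) ht (V k)) hs0).trans ?_
  refine (abs_sub_le _ (normalizedTrace (shiftedInverse (outerSum (J.erase k) V) t)) _).trans ?_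
  refine add_le_add le_rfl ?_
  -- Restoring the omitted term moves the normalized trace by at most 1/(tN).
  have hd := trace_shiftedInverse_sub_trace_add_vecMulVec
    (outerSum_posSemidef (J.erase k) V) ht (V k)
  rw [outerSum_erase_add J V hk] at hd
  rw [hs, normalizedTrace, normalizedTrace, ← sub_div, abs_div, abs_of_pos hN, abs_sub_comm,
    ← div_div]
  exact div_le_div_of_nonneg_right hd hN.le

/-- Stability of the Marchenko-Pastur equation. -/
theorem abs_sub_le_of_marchenkoPastur_equation {t y s r : ℝ} (ht : 0 < t) (hy : 0 ≤ y)
    (hs : 0 ≤ s) (hr : 0 ≤ r) (h : t * r + y * (r / (1 + r)) = 1) :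
    t * |s - r| ≤ |1 - t * s - y * (s / (1 + s))| := by
  -- The second factor is at least t, since u ↦ u/(1 + u) is increasing.
  have e : 1 - t * s - y * (s / (1 + s)) = (r - s) * (t + y / ((1 + r) * (1 + s))) := by
    have h' : 1 - t * s - y * (s / (1 + s)) =
      t * r + y * (r / (1 + r)) - t * s - y * (s / (1 + s)) := by rw [h]
    rw [h']; field_simp; ring
  have hpos : 0 ≤ y / ((1 + r) * (1 + s)) := by positivity
  rw [e, abs_mul, abs_sub_comm s r, abs_of_nonneg (by positivity : 0 ≤ t + y / ((1 + r) * (1 + s)))]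
  nlinarith [abs_nonneg (r - s)]

end OuterSum

/-! ### Concentration of quadratic forms over mutually unbiased bases -/

/-- Bessel's inequality for families whose orthonormal blocks have constant mutual inner products:
it holds for the coefficients of a vector after centering, if the centered coefficients in each
block sum to zero. -/
theorem sum_norm_sq_le_of_const_off_block {E ι κ : Type*} [NormedAddCommGroup E]
    [InnerProductSpace ℂ E] [Fintype ι] [Fintype κ] [DecidableEq ι] [DecidableEq κ]
    (P : ι → κ → E) (c : ℂ)
    (hsame : ∀ i a b, inner ℂ (P i a) (P i b) = if a = b then 1 else 0)
    (hdiff : ∀ i j, i ≠ j → ∀ a b, inner ℂ (P i a) (P j b) = c)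
    (A : E) (D : ι → κ → ℂ) (μ : ℂ) (hA : ∀ i a, inner ℂ (P i a) A = D i a + μ)
    (hD : ∀ i, ∑ a, D i a = 0) :
    ∑ i, ∑ a, ‖D i a‖ ^ 2 ≤ ‖A‖ ^ 2 := by
  -- C plays the role of the projection of A: the zero block sums kill the constant c across blocks
  -- and the constant μ, so ⟨C, A⟩ = ‖C‖² = ∑ |D|², and ‖C − A‖² ≥ 0 finishes.
  set C : E := ∑ j, ∑ b, D j b • P j b with hC
  have hPC : ∀ i a, inner ℂ (P i a) C = D i a + 0 := by
    intro i a
    rw [hC, inner_sum]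
    simp only [inner_sum, inner_smul_right]
    rw [Finset.sum_eq_single i]
    · simp [hsame]
    · intro j _ hji
      simp only [hdiff i j hji.symm, ← Finset.sum_mul, hD, zero_mul]
    · simp
  have hinner : ∀ (X : E) (ν : ℂ), (∀ i a, inner ℂ (P i a) X = D i a + ν) →
      inner ℂ C X = ((∑ i, ∑ a, ‖D i a‖ ^ 2 : ℝ) : ℂ) := by
    intro X ν hX
    have h0 : ∀ i, ∑ a, (starRingEnd ℂ) (D i a) = 0 := fun i => by rw [← map_sum, hD, map_zero]
    rw [hC]
    simp only [sum_inner, inner_smul_left, hX, mul_add, RCLike.conj_mul, Finset.sum_add_distrib,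
      ← Finset.sum_mul, h0]
    simp
  have h1 : RCLike.re (inner ℂ C A) = ∑ i, ∑ a, ‖D i a‖ ^ 2 := by
    rw [hinner A μ hA]; exact Complex.ofReal_re _
  have h2 : ‖C‖ ^ 2 = ∑ i, ∑ a, ‖D i a‖ ^ 2 := by
    rw [← inner_self_eq_norm_sq (𝕜 := ℂ), hinner C 0 hPC]; exact Complex.ofReal_re _
  have h3 := norm_sub_sq (𝕜 := ℂ) C A
  rw [h1, h2] at h3
  nlinarith [sq_nonneg ‖C - A‖]

section Frobenius

variable {n : ℕ}

/-- A matrix as a vector of the Euclidean space indexed by pairs. -/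
noncomputable def matrixVec (A : Matrix (Fin n) (Fin n) ℂ) : EuclideanSpace ℂ (Fin n × Fin n) :=
  WithLp.toLp 2 fun q => A q.1 q.2

theorem inner_matrixVec_vecMulVec (u w : Fin n → ℂ) (A : Matrix (Fin n) (Fin n) ℂ) :
    inner ℂ (matrixVec (Matrix.vecMulVec u (star w))) (matrixVec A) = star u ⬝ᵥ A *ᵥ w := by
  simp only [matrixVec, EuclideanSpace.inner_eq_star_dotProduct, dotProduct, Matrix.mulVec,
    Matrix.vecMulVec_apply, Fintype.sum_prod_type, Finset.mul_sum, Pi.star_apply, star_mul',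
    star_star]
  refine Finset.sum_congr rfl fun i _ => Finset.sum_congr rfl fun j _ => by ring

theorem inner_matrixVec_outer (u w : Fin n → ℂ) :
    inner ℂ (matrixVec (Matrix.vecMulVec u (star u))) (matrixVec (Matrix.vecMulVec w (star w))) =
      ((‖star u ⬝ᵥ w‖ ^ 2 : ℝ) : ℂ) := by
  rw [inner_matrixVec_vecMulVec, Matrix.vecMulVec_mulVec, op_smul_eq_smul, dotProduct_smul,
    smul_eq_mul, Matrix.star_dotProduct w u, ← starRingEnd_apply, RCLike.conj_mul]
  push_cast
  rw [Matrix.star_dotProduct u w, norm_star]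
  simp [dotProduct_comm]

theorem norm_sq_matrixVec (A : Matrix (Fin n) (Fin n) ℂ) :
    ‖matrixVec A‖ ^ 2 = ∑ i, ∑ j, ‖A i j‖ ^ 2 := by
  rw [EuclideanSpace.norm_sq_eq, Fintype.sum_prod_type]
  rfl

/-- The complex conjugate of a vector of an orthonormal basis, as a function. -/
def conjVec (u : EuclideanSpace ℂ (Fin n)) : Fin n → ℂ := fun j => star (u j)

theorem star_conjVec_dotProduct_conjVec (u w : EuclideanSpace ℂ (Fin n)) :
    star (conjVec u) ⬝ᵥ conjVec w = inner ℂ w u := by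
  simp [conjVec, dotProduct, EuclideanSpace.inner_eq_star_dotProduct]

/-- Orthonormality says UU* = 1; U is square, so U*U = 1 as well, and that is the completeness
relation. -/
theorem sum_vecMulVec_conjVec_orthonormalBasis
    (b : OrthonormalBasis (Fin n) ℂ (EuclideanSpace ℂ (Fin n))) :
    ∑ a, Matrix.vecMulVec (conjVec (b a)) (star (conjVec (b a))) = 1 := by
  let U : Matrix (Fin n) (Fin n) ℂ := Matrix.of fun a j => b a j
  have h : U * Uᴴ = 1 := by
    ext a c
    have := orthonormal_iff_ite.1 b.orthonormal c a
    rw [EuclideanSpace.inner_eq_star_dotProduct] at this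
    simp only [dotProduct] at this
    simp only [Matrix.mul_apply, U, Matrix.of_apply, Matrix.conjTranspose_apply, Matrix.one_apply]
    simpa [eq_comm] using this
  have h' := mul_eq_one_comm.1 h
  rw [← h']
  ext i j
  simp [Matrix.sum_apply, Matrix.vecMulVec_apply, conjVec, Matrix.mul_apply, U]

theorem sum_quadraticForm_orthonormalBasis
    (b : OrthonormalBasis (Fin n) ℂ (EuclideanSpace ℂ (Fin n))) (A : Matrix (Fin n) (Fin n) ℂ) :
    ∑ a, star (conjVec (b a)) ⬝ᵥ A *ᵥ conjVec (b a) = A.trace := by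
  have := trace_outerSum_mul Finset.univ (fun a => conjVec (b a)) A
  rw [outerSum, sum_vecMulVec_conjVec_orthonormalBasis, one_mul] at this
  exact this.symm

/-- Quadratic forms at a random vector of mutually unbiased bases concentrate: the traceless
projections of distinct bases are orthogonal. -/
theorem sum_quadraticDeviation_sq_le {m : ℕ} (hn : 0 < n)
    (B : Fin m → OrthonormalBasis (Fin n) ℂ (EuclideanSpace ℂ (Fin n)))
    (hB : MutuallyUnbiased B) (A : Matrix (Fin n) (Fin n) ℂ) :
    ∑ i, ∑ a, quadraticDeviation A (conjVec (B i a)) ^ 2 ≤ ∑ i, ∑ j, ‖A i j‖ ^ 2 := by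
  have hn' : (n : ℂ) ≠ 0 := by exact_mod_cast hn.ne'
  rw [← norm_sq_matrixVec]
  refine le_trans ?_ (sum_norm_sq_le_of_const_off_block
    -- Rank-one projections have Hilbert–Schmidt products |⟨v, w⟩|²: the identity within a basis and
    -- the constant 1/n across bases. Within a basis the quadratic forms add up to tr A, so their
    -- deviations sum to zero.
    (fun i a => matrixVec (Matrix.vecMulVec (conjVec (B i a)) (star (conjVec (B i a)))))
    (1 / n : ℂ) ?_ ?_ (matrixVec A)
    (fun i a => star (conjVec (B i a)) ⬝ᵥ A *ᵥ conjVec (B i a) - A.trace / n) (A.trace / n) ?_ ?_)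
  · refine Finset.sum_le_sum fun i _ => Finset.sum_le_sum fun a _ => ?_
    rw [quadraticDeviation]
    gcongr
    refine le_trans (le_of_eq ?_) (Complex.abs_re_le_norm _)
    rw [normalizedTrace, Fintype.card_fin, Complex.sub_re, Complex.div_natCast_re]
  · intro i a b
    rw [inner_matrixVec_outer, star_conjVec_dotProduct_conjVec,
      orthonormal_iff_ite.1 (B i).orthonormal b a]
    by_cases h : a = b
    · simp [h]
    · simp [h, Ne.symm h]
  · intro i j hij a b
    rw [inner_matrixVec_outer, star_conjVec_dotProduct_conjVec, hB j i hij.symm b a, div_pow,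
      Real.sq_sqrt (Nat.cast_nonneg n)]
    simp
  · intro i a
    rw [inner_matrixVec_vecMulVec, sub_add_cancel]
  · intro i
    rw [Finset.sum_sub_distrib, sum_quadraticForm_orthonormalBasis]
    simp [mul_div_cancel₀ _ hn']

end Frobenius

/-! ### Averaging over the random selection -/

section Average

open Finset
open scoped BigOperators

variable {κ α : Type*} [Fintype κ] [DecidableEq κ] [Fintype α]

/-- Resampling one coordinate of a uniform random function does not change averages. -/
theorem expect_expect_update [Nonempty α] (f : (κ → α) → ℝ) (k : κ) :
    𝔼 s, 𝔼 v, f (Function.update s k v) = 𝔼 s, f s := by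
  have hα : (Fintype.card α : ℝ) ≠ 0 := by exact_mod_cast Fintype.card_ne_zero
  -- Swapping the old k-th value with the fresh one permutes the pairs (s, v), so it can serve as a
  -- reindexing.
  have hinv : Function.Involutive
      (fun q : (κ → α) × α => (Function.update q.1 k q.2, q.1 k)) := by
    rintro ⟨s, v⟩
    simp
  have h : ∑ q : (κ → α) × α, f (Function.update q.1 k q.2) = ∑ q : (κ → α) × α, f q.1 :=
    Equiv.sum_comp hinv.toPerm (fun q => f q.1)
  rw [Fintype.sum_prod_type, Fintype.sum_prod_type] at h
  simp only [Finset.sum_const, Finset.card_univ, nsmul_eq_mul, ← Finset.mul_sum] at h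
  simp only [Fintype.expect_eq_sum_div_card, ← Finset.sum_div, h]
  field_simp

theorem expect_le_sqrt_expect_sq {Ω : Type*} [Fintype Ω] (f : Ω → ℝ) :
    𝔼 s, f s ≤ √(𝔼 s, f s ^ 2) := by
  refine Real.le_sqrt_of_sq_le ?_
  rcases isEmpty_or_nonempty Ω with hΩ | hΩ
  · simp [Finset.univ_eq_empty]
  · have hc : (0 : ℝ) < Fintype.card Ω := by exact_mod_cast Fintype.card_pos
    rw [Fintype.expect_eq_sum_div_card, Fintype.expect_eq_sum_div_card, div_pow,
      div_le_div_iff₀ (by positivity) hc]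
    have := sq_sum_le_card_mul_sum_sq (s := (Finset.univ : Finset Ω)) (f := f)
    rw [Finset.card_univ] at this
    nlinarith

variable {n m p : ℕ}

/-- The family of conjugated rows of the matrix attached to a selection. -/
noncomputable def conjRows (B : Fin m → OrthonormalBasis (Fin n) ℂ (EuclideanSpace ℂ (Fin n)))
    (s : Selection p m n) (k : Fin p) : Fin n → ℂ := conjVec (B (s k).1 (s k).2)

theorem outerSum_erase_conjRows_update
    (B : Fin m → OrthonormalBasis (Fin n) ℂ (EuclideanSpace ℂ (Fin n)))
    (s : Selection p m n) (k : Fin p) (v : Fin m × Fin n) :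
    outerSum (univ.erase k) (conjRows B (Function.update s k v)) =
      outerSum (univ.erase k) (conjRows B s) := by
  refine Finset.sum_congr rfl fun j hj => ?_
  simp [conjRows, Function.update_of_ne (Finset.ne_of_mem_erase hj)]

/-- Resample the k-th vector with the resolvent held fixed: the Bessel sum is at most n/t², spread
over mn vectors, so the mean square is at most 1/(t²m). Cauchy–Schwarz gives the first moment. -/
theorem expect_quadraticDeviation_le (hn : 0 < n) (hm : 0 < m)
    (B : Fin m → OrthonormalBasis (Fin n) ℂ (EuclideanSpace ℂ (Fin n)))
    (hB : MutuallyUnbiased B) {t : ℝ} (ht : 0 < t) (k : Fin p) :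
    𝔼 s : Selection p m n, quadraticDeviation
      (shiftedInverse (outerSum (univ.erase k) (conjRows B s)) t) (conjRows B s k) ≤
      1 / (t * √m) := by
  have : Nonempty (Fin m × Fin n) := ⟨⟨⟨0, hm⟩, ⟨0, hn⟩⟩⟩
  have hn' : (0 : ℝ) < n := by exact_mod_cast hn
  have hm' : (0 : ℝ) < m := by exact_mod_cast hm
  refine (expect_le_sqrt_expect_sq _).trans ?_
  rw [← expect_expect_update _ k, Real.sqrt_le_left (by positivity), div_pow, one_pow, mul_pow,
    Real.sq_sqrt hm'.le]
  refine (Finset.expect_le_expect (g := fun _ => 1 / (t ^ 2 * m)) fun s _ => ?_).trans_eq ?_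
  · simp only [outerSum_erase_conjRows_update]
    set R := shiftedInverse (outerSum (univ.erase k) (conjRows B s)) t
    have h1 := sum_quadraticDeviation_sq_le hn B hB R
    have h2 : ∑ i, ∑ j, ‖R i j‖ ^ 2 ≤ _ :=
      sum_norm_sq_shiftedInverse_le (outerSum_posSemidef (univ.erase k) (conjRows B s)) ht
    rw [Fintype.card_fin] at h2
    rw [Fintype.expect_eq_sum_div_card, Fintype.sum_prod_type, Fintype.card_prod,
      Fintype.card_fin, Fintype.card_fin, div_le_div_iff₀ (by positivity) (by positivity)]
    simp only [conjRows, Function.update_self]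
    have h3 := h1.trans h2
    rw [le_div_iff₀ (by positivity)] at h3
    push_cast
    nlinarith
  · exact Fintype.expect_const _

/-- The expected error of the normalized resolvent trace. -/
theorem expect_abs_normalizedTrace_sub_le (hn : 0 < n) (hm : 0 < m)
    (B : Fin m → OrthonormalBasis (Fin n) ℂ (EuclideanSpace ℂ (Fin n)))
    (hB : MutuallyUnbiased B) {t r : ℝ} (ht : 0 < t) (hr : 0 ≤ r)
    (h : t * r + (p / n : ℝ) * (r / (1 + r)) = 1) :
    𝔼 s : Selection p m n,
      |normalizedTrace (shiftedInverse (outerSum univ (conjRows B s)) t) - r| ≤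
      t⁻¹ * ((p / n : ℝ) * (1 / (t * √m) + 1 / (t * n))) := by
  have : Nonempty (Fin m × Fin n) := ⟨⟨⟨0, hm⟩, ⟨0, hn⟩⟩⟩
  have : Nonempty (Fin n) := ⟨⟨0, hn⟩⟩
  have hn' : (0 : ℝ) < n := by exact_mod_cast hn
  have key : ∀ s : Selection p m n,
      |normalizedTrace (shiftedInverse (outerSum univ (conjRows B s)) t) - r| ≤
      t⁻¹ * ((n : ℝ)⁻¹ * ∑ k : Fin p, (quadraticDeviation
        (shiftedInverse (outerSum (univ.erase k) (conjRows B s)) t) (conjRows B s k)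
          + 1 / (t * n))) := by
    intro s
    have h1 := marchenkoPastur_equation_defect_le univ (conjRows B s) ht
    simp only [Finset.card_univ, Fintype.card_fin] at h1
    have h2 := abs_sub_le_of_marchenkoPastur_equation (y := (p / n : ℝ))
      (s := normalizedTrace (shiftedInverse (outerSum univ (conjRows B s)) t)) ht (by positivity)
      (div_nonneg (trace_shiftedInverse_nonneg (outerSum_posSemidef _ _) ht) (by simp)) hr h
    rw [inv_mul_eq_div, le_div_iff₀' ht]
    exact h2.trans h1
  refine (Finset.expect_le_expect fun s _ => key s).trans ?_
  rw [← Finset.mul_expect, ← Finset.mul_expect, Finset.expect_sum_comm]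
  refine mul_le_mul_of_nonneg_left ?_ (inv_pos.2 ht).le
  rw [div_eq_inv_mul (p : ℝ), mul_assoc]
  refine mul_le_mul_of_nonneg_left ?_ (inv_pos.2 hn').le
  calc _ ≤ ∑ _k : Fin p, (1 / (t * √m) + 1 / (t * n)) := by
        refine Finset.sum_le_sum fun k _ => ?_
        rw [Finset.expect_add_distrib, Fintype.expect_const]
        exact add_le_add (expect_quadraticDeviation_le hn hm B hB ht k) le_rfl
    _ = _ := by rw [Finset.sum_const, Finset.card_univ, Fintype.card_fin, nsmul_eq_mul]

end Average

/-! ### From the n × n resolvent to the eigenvalues of the Gram matrix -/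

section GramEigenvalues

open scoped ComplexOrder

theorem trace_shiftedInverse_eq_sum_eigenvalues {ι : Type*} [Fintype ι] [DecidableEq ι]
    {K : Matrix ι ι ℂ} (hK : K.PosSemidef) (hH : K.IsHermitian) {t : ℝ} (ht : 0 < t) :
    (shiftedInverse K t).trace.re = ∑ i, (hH.eigenvalues i + t)⁻¹ := by
  set U := (hH.eigenvectorUnitary : Matrix ι ι ℂ) with hU
  have hUU : star U * U = 1 := Unitary.coe_star_mul_self _
  have hUU' : U * star U = 1 := Unitary.coe_mul_star_self _
  have hspec : K = U * Matrix.diagonal (RCLike.ofReal ∘ hH.eigenvalues) * star U := by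
    conv_lhs => rw [hH.spectral_theorem, Unitary.conjStarAlgAut_apply]
  set D : Matrix ι ι ℂ := Matrix.diagonal (RCLike.ofReal ∘ hH.eigenvalues) with hD
  set E : Matrix ι ι ℂ := Matrix.diagonal fun i => (((hH.eigenvalues i + t)⁻¹ : ℝ) : ℂ) with hE
  have hDE : (D + (t : ℂ) • (1 : Matrix ι ι ℂ)) * E = 1 := by
    rw [hD, hE, ← Matrix.diagonal_one, ← Matrix.diagonal_smul, Matrix.diagonal_add,
      Matrix.diagonal_mul_diagonal]
    congr 1
    ext i
    have h0 := hK.eigenvalues_nonneg i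
    have h1 : ((hH.eigenvalues i : ℂ) + t) ≠ 0 := by
      exact_mod_cast (by positivity : hH.eigenvalues i + t ≠ 0)
    simp [mul_inv_cancel₀ h1]
  have hinv : shiftedInverse K t = U * E * star U := by
    refine Matrix.inv_eq_right_inv ?_
    have e : K + (t : ℂ) • (1 : Matrix ι ι ℂ) =
        U * (D + (t : ℂ) • (1 : Matrix ι ι ℂ)) * star U := by
      rw [mul_add, add_mul, ← hspec, Matrix.mul_smul, mul_one, Matrix.smul_mul, hUU']
    calc (K + (t : ℂ) • (1 : Matrix ι ι ℂ)) * (U * E * star U)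
        = U * (D + (t : ℂ) • (1 : Matrix ι ι ℂ)) * (star U * U) * E * star U := by
          rw [e]; simp only [mul_assoc]
      _ = 1 := by rw [hUU, mul_one, mul_assoc U, hDE, mul_one, hUU']
  rw [hinv, Matrix.trace_mul_comm, ← mul_assoc, hUU, one_mul, hE, Matrix.trace_diagonal,
    ← Complex.ofReal_sum, Complex.ofReal_re]

/-- Trace of the push-through identity t(Φ*Φ + t)⁻¹ = 1 − Φ*(ΦΦ* + t)⁻¹Φ. It reflects that the two
products share their nonzero spectrum. -/
theorem trace_shiftedInverse_conjTranspose_mul_self {ι κ : Type*} [Fintype ι] [DecidableEq ι]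
    [Fintype κ] [DecidableEq κ] (Φ : Matrix κ ι ℂ) {t : ℝ} (ht : 0 < t) :
    t * (shiftedInverse (Φᴴ * Φ) t).trace.re =
      Fintype.card ι - Fintype.card κ + t * (shiftedInverse (Φ * Φᴴ) t).trace.re := by
  have h1 := add_smul_one_mul_shiftedInverse (Matrix.posSemidef_self_mul_conjTranspose Φ) ht
  have h2 := shiftedInverse_mul_add_smul_one (Matrix.posSemidef_conjTranspose_mul_self Φ) ht
  set R := shiftedInverse (Φ * Φᴴ) t
  set R' := shiftedInverse (Φᴴ * Φ) t
  have h3 : (Φᴴ * Φ + (t : ℂ) • (1 : Matrix ι ι ℂ)) * (1 - Φᴴ * R * Φ) =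
      (t : ℂ) • (1 : Matrix ι ι ℂ) := by
    have e : (Φᴴ * Φ + (t : ℂ) • (1 : Matrix ι ι ℂ)) * (Φᴴ * R * Φ) =
        Φᴴ * ((Φ * Φᴴ + (t : ℂ) • (1 : Matrix κ κ ℂ)) * R) * Φ := by
      simp only [add_mul, Matrix.smul_mul, Matrix.mul_smul, Matrix.one_mul,
        Matrix.mul_assoc, Matrix.mul_add, Matrix.add_mul]
    rw [mul_sub, e, h1, mul_one, Matrix.mul_one, add_sub_cancel_left]
  have h4 : (t : ℂ) • R' = 1 - Φᴴ * R * Φ := by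
    have := congrArg (R' * ·) h3
    simp only [← mul_assoc, h2, one_mul, Matrix.mul_smul, mul_one] at this
    exact this.symm
  have h5 := congrArg Matrix.trace h4
  have h6 := congrArg Matrix.trace h1
  rw [Matrix.trace_smul, Matrix.trace_sub, Matrix.trace_one, Matrix.trace_mul_comm,
    ← Matrix.mul_assoc] at h5
  rw [add_mul, Matrix.trace_add, Matrix.trace_one, Matrix.smul_mul, Matrix.one_mul,
    Matrix.trace_smul] at h6
  rw [eq_sub_of_add_eq h6] at h5
  have h7 := congrArg Complex.re h5
  simp only [smul_eq_mul, Complex.re_ofReal_mul, Complex.sub_re, Complex.natCast_re] at h7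
  rw [h7]
  ring

variable {p m n : ℕ}

/-- This is the reason for conjugating the rows: (Φ*Φ)ᵢⱼ is the sum over k of conj(Φₖᵢ)Φₖⱼ. -/
theorem outerSum_conjRows (B : Fin m → OrthonormalBasis (Fin n) ℂ (EuclideanSpace ℂ (Fin n)))
    (s : Selection p m n) :
    outerSum Finset.univ (conjRows B s) = (rowMatrix B s)ᴴ * rowMatrix B s := by
  ext i j
  simp [outerSum, Matrix.sum_apply, Matrix.vecMulVec_apply, conjRows, conjVec, Matrix.mul_apply,
    rowMatrix]

/-- The eigenvalues of the Gram matrix of a family of rows. -/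
noncomputable def gramEigenvalues (Φ : Matrix (Fin p) (Fin n) ℂ) (i : Fin p) : ℝ :=
  (Matrix.isHermitian_mul_conjTranspose_self Φ).eigenvalues i

theorem gramEigenvalues_nonneg (Φ : Matrix (Fin p) (Fin n) ℂ) (i : Fin p) :
    0 ≤ gramEigenvalues Φ i :=
  (Matrix.posSemidef_self_mul_conjTranspose Φ).eigenvalues_nonneg i

/-- The average of a function over the eigenvalues of the Gram matrix. -/
noncomputable def eigenvalueMean (Φ : Matrix (Fin p) (Fin n) ℂ) (g : ℝ → ℝ) : ℝ :=
  (∑ i, g (gramEigenvalues Φ i)) / p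

theorem normalizedTrace_eq_eigenvalueMean (hn : 0 < n) (hp : 0 < p)
    (B : Fin m → OrthonormalBasis (Fin n) ℂ (EuclideanSpace ℂ (Fin n)))
    (s : Selection p m n) {t : ℝ} (ht : 0 < t) :
    normalizedTrace (shiftedInverse (outerSum Finset.univ (conjRows B s)) t) =
      (1 - p / n) / t + p / n * eigenvalueMean (rowMatrix B s) fun x => (x + t)⁻¹ := by
  have hn' : (0 : ℝ) < n := by exact_mod_cast hn
  have hp' : (0 : ℝ) < p := by exact_mod_cast hp
  have h := trace_shiftedInverse_conjTranspose_mul_self (rowMatrix B s) ht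
  rw [trace_shiftedInverse_eq_sum_eigenvalues (Matrix.posSemidef_self_mul_conjTranspose _)
    (Matrix.isHermitian_mul_conjTranspose_self _) ht, Fintype.card_fin, Fintype.card_fin] at h
  rw [outerSum_conjRows, normalizedTrace, Fintype.card_fin, eigenvalueMean]
  change _ = _ + _ * ((∑ i, ((Matrix.isHermitian_mul_conjTranspose_self _).eigenvalues i + t)⁻¹) / _)
  generalize (∑ i, ((Matrix.isHermitian_mul_conjTranspose_self
    (rowMatrix B s)).eigenvalues i + t)⁻¹) = S at h ⊢
  field_simp
  linarith

theorem gramESD_eq (Φ : Matrix (Fin p) (Fin n) ℂ) (x : ℝ) :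
    gramESD Φ x = eigenvalueMean Φ (Set.indicator (Set.Iic x) 1) := by
  rw [gramESD, empiricalSpectralDistribution, spectralMeasure, measureReal_ennreal_smul_apply,
    measureReal_def, Measure.finsetSum_apply, ENNReal.toReal_sum, eigenvalueMean, div_eq_inv_mul]
  · simp only [ENNReal.toReal_inv, ENNReal.toReal_natCast]
    congr 1
    refine Finset.sum_congr rfl fun i _ => ?_
    rw [Measure.dirac_apply' _ measurableSet_Iic]
    by_cases h : gramEigenvalues Φ i ≤ x
    · have h' : (Matrix.isHermitian_mul_conjTranspose_self Φ).eigenvalues i ≤ x := h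
      simp [Set.indicator, h, h']
    · have h' : ¬ (Matrix.isHermitian_mul_conjTranspose_self Φ).eigenvalues i ≤ x := h
      simp [Set.indicator, h, h']
  · intro i _
    exact measure_ne_top _ _

end GramEigenvalues

/-! ### Integrals against the Marchenko–Pastur law -/

section MarchenkoPasturIntegrals

theorem integral_sqrt_mul_div {a b : ℝ} (ha : 0 < a) (hab : a < b) :
    ∫ x in a..b, √((b - x) * (x - a)) / x = Real.pi * ((a + b) / 2 - √(a * b)) := by
  have hba : 0 < b - a := sub_pos.2 hab
  have hb : 0 < b := ha.trans hab
  -- An explicit primitive on (a, b). Both arcsine arguments run from −1 at a to 1 at b, and the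
  -- root vanishes at both ends.
  let F : ℝ → ℝ := fun x => √((b - x) * (x - a)) +
    (a + b) / 2 * Real.arcsin ((2 * x - a - b) / (b - a)) -
    √(a * b) * Real.arcsin (((a + b) * x - 2 * (a * b)) / (x * (b - a)))
  have hne : ∀ x ∈ Set.Icc a b, x ≠ 0 := fun x hx => (ha.trans_le hx.1).ne'
  have hcont : ContinuousOn F (Set.Icc a b) := by
    refine ContinuousOn.sub (by fun_prop) (ContinuousOn.mul continuousOn_const
      (Real.continuous_arcsin.comp_continuousOn (ContinuousOn.div (by fun_prop) (by fun_prop) ?_)))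
    exact fun x hx => mul_ne_zero (hne x hx) hba.ne'
  have hderiv : ∀ x ∈ Set.Ioo a b, HasDerivAt F (√((b - x) * (x - a)) / x) x := by
    intro x ⟨hx1, hx2⟩
    have hx0 : 0 < x := ha.trans hx1
    have h1 : 0 < b - x := sub_pos.2 hx2
    have h2 : 0 < x - a := sub_pos.2 hx1
    have hQ : 0 < (b - x) * (x - a) := mul_pos h1 h2
    set q := √((b - x) * (x - a)) with hq
    have hq0 : 0 < q := Real.sqrt_pos.2 hQ
    have hqq : q ^ 2 = (b - x) * (x - a) := Real.sq_sqrt hQ.le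
    set g := √(a * b) with hg
    have hg0 : 0 < g := Real.sqrt_pos.2 (mul_pos ha hb)
    have hgg : g ^ 2 = a * b := Real.sq_sqrt (mul_pos ha hb).le
    have d1 : HasDerivAt (fun x => √((b - x) * (x - a)))
        ((-1 * (x - a) + (b - x) * 1) / (2 * q)) x :=
      (((hasDerivAt_id x).const_sub b).mul ((hasDerivAt_id x).sub_const a)).sqrt hQ.ne'
    have w1 : 1 - ((2 * x - a - b) / (b - a)) ^ 2 = (2 * q / (b - a)) ^ 2 := by
      rw [div_pow, div_pow, mul_pow, hqq]; field_simp; ring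
    have w2 : 1 - (((a + b) * x - 2 * (a * b)) / (x * (b - a))) ^ 2 =
        (2 * g * q / (x * (b - a))) ^ 2 := by
      rw [div_pow, div_pow, mul_pow (2 * g) q, mul_pow 2 g, hqq, hgg]; field_simp; ring
    have ne_of : ∀ w r : ℝ, 0 < r → 1 - w ^ 2 = r ^ 2 → w ≠ -1 ∧ w ≠ 1 := by
      intro w r hr h
      constructor <;> rintro rfl <;> nlinarith [pow_pos hr 2]
    have p1 : 0 < 2 * q / (b - a) := by positivity
    have p2 : 0 < 2 * g * q / (x * (b - a)) := by positivity
    have d2 := (Real.hasDerivAt_arcsin (ne_of _ _ p1 w1).1 (ne_of _ _ p1 w1).2).comp x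
      (((((hasDerivAt_id x).const_mul 2).sub_const a).sub_const b).div_const (b - a))
    have d3 := (Real.hasDerivAt_arcsin (ne_of _ _ p2 w2).1 (ne_of _ _ p2 w2).2).comp x
      ((((hasDerivAt_id x).const_mul (a + b)).sub_const (2 * (a * b))).div
        ((hasDerivAt_id x).mul_const (b - a)) (mul_pos hx0 hba).ne')
    rw [w1, Real.sqrt_sq p1.le] at d2
    rw [w2, Real.sqrt_sq p2.le] at d3
    refine ((d1.add (d2.const_mul ((a + b) / 2))).sub (d3.const_mul g)).congr_deriv ?_
    have hqx : q / x = ((b - x) * (x - a)) / (x * q) := by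
      rw [← hqq]; field_simp
    rw [hqx]
    simp only [id]
    have hba' := hba.ne'
    field_simp
    ring
  have hint : IntervalIntegrable (fun x => √((b - x) * (x - a)) / x) volume a b := by
    refine ContinuousOn.intervalIntegrable ?_
    rw [Set.uIcc_of_le hab.le]
    exact ContinuousOn.div (by fun_prop) (by fun_prop) hne
  rw [intervalIntegral.integral_eq_sub_of_hasDerivAt_of_le hab.le hcont hderiv hint]
  have e1 : (2 * b - a - b) / (b - a) = 1 := by rw [div_eq_one_iff_eq hba.ne']; ring
  have e2 : ((a + b) * b - 2 * (a * b)) / (b * (b - a)) = 1 := by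
    rw [div_eq_one_iff_eq (mul_pos hb hba).ne']; ring
  have e3 : (2 * a - a - b) / (b - a) = -1 := by
    rw [div_eq_iff hba.ne']; ring
  have e4 : ((a + b) * a - 2 * (a * b)) / (a * (b - a)) = -1 := by
    rw [div_eq_iff (mul_pos ha hba).ne']; ring
  simp only [F, e1, e2, e3, e4, Real.arcsin_one, Real.arcsin_neg_one, sub_self, zero_mul, mul_zero,
    Real.sqrt_zero]
  ring

theorem integral_sqrt_mul_div_add {a b c : ℝ} (ha : 0 < a + c) (hab : a < b) :
    ∫ x in a..b, √((b - x) * (x - a)) / (x + c) =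
      Real.pi * ((a + b) / 2 + c - √((a + c) * (b + c))) := by
  have h := integral_sqrt_mul_div ha (add_lt_add_left hab c)
  have e := intervalIntegral.integral_comp_add_right (a := a) (b := b)
    (fun x => √((b + c - x) * (x - (a + c))) / x) c
  simp only [add_sub_add_right_eq_sub] at e
  rw [e, h]
  ring

variable {y : ℝ}

theorem marchenkoPastur_edges (hy : y ∈ Set.Ioo (0 : ℝ) 1) :
    0 < (1 - √y) ^ 2 ∧ (1 - √y) ^ 2 < (1 + √y) ^ 2 := by
  have h1 : 0 < √y := Real.sqrt_pos.2 hy.1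
  have h2 : √y < 1 := by rw [Real.sqrt_lt' one_pos]; simpa using hy.2
  constructor
  · have : 0 < 1 - √y := by linarith
    positivity
  · nlinarith

theorem marchenkoPasturDensity_nonneg (hy : y ∈ Set.Ioo (0 : ℝ) 1) (x : ℝ) :
    0 ≤ marchenkoPasturDensity y x := by
  refine Set.indicator_nonneg (fun t ht => ?_) x
  have h1 : 0 < t := (marchenkoPastur_edges hy).1.trans_le ht.1
  have := hy.1
  have := Real.pi_pos
  positivity

theorem measurable_marchenkoPasturDensity : Measurable (marchenkoPasturDensity y) := by
  unfold marchenkoPasturDensity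
  refine Measurable.indicator ?_ measurableSet_Icc
  fun_prop

theorem integral_marchenkoPasturLaw (hy : y ∈ Set.Ioo (0 : ℝ) 1) (g : ℝ → ℝ) :
    ∫ x, g x ∂marchenkoPasturLaw y = (2 * Real.pi * y)⁻¹ *
      ∫ x in ((1 - √y) ^ 2)..((1 + √y) ^ 2),
        √(((1 + √y) ^ 2 - x) * (x - (1 - √y) ^ 2)) / x * g x := by
  rw [marchenkoPasturLaw, integral_withDensity_eq_integral_toReal_smul
    measurable_marchenkoPasturDensity.ennreal_ofReal (by simp)]
  simp only [ENNReal.toReal_ofReal (marchenkoPasturDensity_nonneg hy _)]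
  rw [intervalIntegral.integral_of_le (marchenkoPastur_edges hy).2.le,
    ← integral_Icc_eq_integral_Ioc, ← integral_const_mul, ← integral_indicator measurableSet_Icc]
  congr 1
  ext x
  by_cases hx : x ∈ Set.Icc ((1 - √y) ^ 2) ((1 + √y) ^ 2)
  · simp only [marchenkoPasturDensity, Set.indicator_of_mem hx, smul_eq_mul]
    have : x ≠ 0 := ((marchenkoPastur_edges hy).1.trans_le hx.1).ne'
    have := hy.1.ne'
    field_simp
  · simp [marchenkoPasturDensity, Set.indicator_of_notMem hx]

theorem marchenkoPastur_edges_add (hy : 0 ≤ y) : (1 - √y) ^ 2 + (1 + √y) ^ 2 = 2 * (1 + y) := by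
  have := Real.sq_sqrt hy
  linear_combination 2 * this

theorem marchenkoPastur_edges_mul (hy : 0 ≤ y) :
    (1 - √y) ^ 2 * (1 + √y) ^ 2 = (1 - y) ^ 2 := by
  have := Real.sq_sqrt hy
  rw [← mul_pow]
  congr 1
  linear_combination - this

/-- Here √(ab) = 1 − y because y < 1, while (a + b)/2 = 1 + y. This is the normalization of the
density. -/
theorem integral_sqrt_div_marchenkoPastur (hy : y ∈ Set.Ioo (0 : ℝ) 1) :
    ∫ x in ((1 - √y) ^ 2)..((1 + √y) ^ 2),
        √(((1 + √y) ^ 2 - x) * (x - (1 - √y) ^ 2)) / x = 2 * Real.pi * y := by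
  obtain ⟨ha, hab⟩ := marchenkoPastur_edges hy
  rw [integral_sqrt_mul_div ha hab, marchenkoPastur_edges_add hy.1.le,
    marchenkoPastur_edges_mul hy.1.le, Real.sqrt_sq (by linarith [hy.2])]
  ring

theorem isProbabilityMeasure_marchenkoPasturLaw (hy : y ∈ Set.Ioo (0 : ℝ) 1) :
    IsProbabilityMeasure (marchenkoPasturLaw y) := by
  have h := integral_marchenkoPasturLaw hy fun _ => 1
  simp only [mul_one, integral_sqrt_div_marchenkoPastur hy] at h
  have := hy.1
  have := Real.pi_pos
  rw [inv_mul_cancel₀ (by positivity), integral_const, smul_eq_mul, mul_one, measureReal_def,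
    ENNReal.toReal_eq_one_iff] at h
  exact ⟨h⟩

theorem integral_inv_add_marchenkoPasturLaw (hy : y ∈ Set.Ioo (0 : ℝ) 1) {t : ℝ} (ht : 0 < t) :
    ∫ x, (x + t)⁻¹ ∂marchenkoPasturLaw y =
      (y - 1 - t + √((1 - y - t) ^ 2 + 4 * t)) / (2 * y * t) := by
  obtain ⟨ha, hab⟩ := marchenkoPastur_edges hy
  rw [integral_marchenkoPasturLaw hy]
  -- Partial fractions: 1/(x(x + t)) = t⁻¹(1/x − 1/(x + t)).
  have e : ∫ x in ((1 - √y) ^ 2)..((1 + √y) ^ 2),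
        √(((1 + √y) ^ 2 - x) * (x - (1 - √y) ^ 2)) / x * (x + t)⁻¹ =
      t⁻¹ * ((∫ x in ((1 - √y) ^ 2)..((1 + √y) ^ 2),
        √(((1 + √y) ^ 2 - x) * (x - (1 - √y) ^ 2)) / x) -
      ∫ x in ((1 - √y) ^ 2)..((1 + √y) ^ 2),
        √(((1 + √y) ^ 2 - x) * (x - (1 - √y) ^ 2)) / (x + t)) := by
    have hpos : ∀ x ∈ Set.uIcc ((1 - √y) ^ 2) ((1 + √y) ^ 2), 0 < x := fun x hx => by
      rw [Set.uIcc_of_le hab.le] at hx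
      exact ha.trans_le hx.1
    rw [← intervalIntegral.integral_sub, ← intervalIntegral.integral_const_mul]
    · refine intervalIntegral.integral_congr fun x hx => ?_
      have h0 := hpos x hx
      have h1 : x + t ≠ 0 := by positivity
      field_simp
      ring
    · exact (ContinuousOn.div (by fun_prop) (by fun_prop)
        fun x hx => (hpos x hx).ne').intervalIntegrable
    · exact (ContinuousOn.div (by fun_prop) (by fun_prop)
        fun x hx => (add_pos (hpos x hx) ht).ne').intervalIntegrable
  have hD : ((1 - √y) ^ 2 + t) * ((1 + √y) ^ 2 + t) = (1 - y - t) ^ 2 + 4 * t := by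
    linear_combination marchenkoPastur_edges_mul hy.1.le + t * marchenkoPastur_edges_add hy.1.le
  rw [e, integral_sqrt_div_marchenkoPastur hy, integral_sqrt_mul_div_add (by positivity) hab, hD,
    marchenkoPastur_edges_add hy.1.le]
  have := hy.1
  have := Real.pi_pos
  field_simp
  ring

/-- The Stieltjes transform of the companion law solves the Marchenko-Pastur equation. -/
theorem marchenkoPastur_equation (hy : y ∈ Set.Ioo (0 : ℝ) 1) {t : ℝ} (ht : 0 < t) :
    0 ≤ (1 - y) / t + y * ∫ x, (x + t)⁻¹ ∂marchenkoPasturLaw y ∧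
    t * ((1 - y) / t + y * ∫ x, (x + t)⁻¹ ∂marchenkoPasturLaw y) +
      y * (((1 - y) / t + y * ∫ x, (x + t)⁻¹ ∂marchenkoPasturLaw y) /
        (1 + ((1 - y) / t + y * ∫ x, (x + t)⁻¹ ∂marchenkoPasturLaw y))) = 1 := by
  have hy0 := hy.1
  set w := √((1 - y - t) ^ 2 + 4 * t) with hw
  have hww : w ^ 2 = (1 - y - t) ^ 2 + 4 * t := Real.sq_sqrt (by positivity)
  have hw0 : |1 - y - t| ≤ w := Real.abs_le_sqrt (by linarith)
  -- The nonnegative root of tr² + (t + y − 1)r − 1 = 0, which is the target equation cleared of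
  -- denominators.
  have e : (1 - y) / t + y * ∫ x, (x + t)⁻¹ ∂marchenkoPasturLaw y =
      (1 - y - t + w) / (2 * t) := by
    rw [integral_inv_add_marchenkoPasturLaw hy ht, ← hw]
    field_simp
    ring
  rw [e]
  have h1 : 0 ≤ 1 - y - t + w := by linarith [neg_abs_le (1 - y - t)]
  have h2 : 0 ≤ (1 - y - t + w) / (2 * t) := by positivity
  refine ⟨h2, ?_⟩
  have h3 : 1 + (1 - y - t + w) / (2 * t) ≠ 0 := by positivity
  have h4 : 2 * t + (1 - y - t + w) ≠ 0 := by positivity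
  field_simp
  linear_combination hww

end MarchenkoPasturIntegrals

/-! ### From Stieltjes transforms to distribution functions -/

section MeanConvergence

open scoped BigOperators

set_option linter.unusedSectionVars false

variable {Ω : ℕ → Type*} [∀ k, Fintype (Ω k)] {N : ℕ → ℕ}

/-- The averages of `g` over random points `lam k ω i`, `i < N k`, with `ω` uniform in `Ω k`,
converge in mean to the integral of `g`. -/
def MeanConverges (lam : ∀ k, Ω k → Fin (N k) → ℝ) (μ : Measure ℝ) (g : ℝ → ℝ) : Prop :=
  Tendsto (fun k => 𝔼 ω, |(∑ i, g (lam k ω i)) / N k - ∫ x, g x ∂μ|) atTop (𝓝 0)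

theorem meanConverges_of_le {lam : ∀ k, Ω k → Fin (N k) → ℝ} {μ : Measure ℝ} {g : ℝ → ℝ}
    {u : ℕ → ℝ} (hu : Tendsto u atTop (𝓝 0))
    (h : ∀ k, 𝔼 ω, |(∑ i, g (lam k ω i)) / N k - ∫ x, g x ∂μ| ≤ u k) :
    MeanConverges lam μ g :=
  squeeze_zero (fun _ => Finset.expect_nonneg fun _ _ => abs_nonneg _) h hu

theorem MeanConverges.add {lam : ∀ k, Ω k → Fin (N k) → ℝ} {μ : Measure ℝ} {f g : ℝ → ℝ}
    (hf : MeanConverges lam μ f) (hg : MeanConverges lam μ g) (hfi : Integrable f μ)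
    (hgi : Integrable g μ) : MeanConverges lam μ fun x => f x + g x := by
  refine meanConverges_of_le (by simpa using Tendsto.add hf hg) fun k => ?_
  rw [← Finset.expect_add_distrib]
  refine Finset.expect_le_expect fun ω _ => ?_
  rw [integral_add hfi hgi, Finset.sum_add_distrib, add_div, add_sub_add_comm]
  exact abs_add_le _ _

theorem MeanConverges.const_mul {lam : ∀ k, Ω k → Fin (N k) → ℝ} {μ : Measure ℝ} {f : ℝ → ℝ}
    (hf : MeanConverges lam μ f) (c : ℝ) : MeanConverges lam μ fun x => c * f x := by
  refine meanConverges_of_le (by simpa using Tendsto.const_mul |c| hf) fun k => ?_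
  rw [Finset.mul_expect]
  refine Finset.expect_le_expect fun ω _ => ?_
  rw [integral_const_mul, ← Finset.mul_sum, mul_div_assoc, ← mul_sub, abs_mul]

variable (lam : ∀ k, Ω k → Fin (N k) → ℝ) (hlam : ∀ k ω i, 0 ≤ lam k ω i) (hN : ∀ k, 0 < N k)
  (hΩ : ∀ k, Nonempty (Ω k)) (μ : Measure ℝ) [IsProbabilityMeasure μ] (hμ : ∀ᵐ x ∂μ, 0 ≤ x)

include hN in
theorem meanConverges_const (c : ℝ) : MeanConverges lam μ fun _ => c := by
  refine meanConverges_of_le tendsto_const_nhds fun k => le_of_eq ?_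
  have : (N k : ℝ) ≠ 0 := by exact_mod_cast (hN k).ne'
  simp [this]

include hlam hN hΩ hμ in
-- The error for g is at most the errors for l and u plus the gap of their integrals. Comparison on
-- [0, ∞) suffices, since the points and μ live there.
theorem meanConverges_of_sandwich {g : ℝ → ℝ} (hgi : Integrable g μ)
    (h : ∀ ε > 0, ∃ l u : ℝ → ℝ, MeanConverges lam μ l ∧ MeanConverges lam μ u ∧
      Integrable l μ ∧ Integrable u μ ∧ (∀ x, 0 ≤ x → l x ≤ g x) ∧ (∀ x, 0 ≤ x → g x ≤ u x) ∧
      ∫ x, u x ∂μ - ∫ x, l x ∂μ ≤ ε) :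
    MeanConverges lam μ g := by
  rw [MeanConverges, Metric.tendsto_atTop]
  intro ε hε
  obtain ⟨l, u, hl, hu, hli, hui, hlg, hgu, hint⟩ := h (ε / 2) (by positivity)
  obtain ⟨K, hK⟩ := Metric.tendsto_atTop.1 (Tendsto.add hl hu) (ε / 2) (by positivity)
  refine ⟨K, fun k hk => ?_⟩
  have hNk : (0 : ℝ) < N k := by exact_mod_cast hN k
  have hk := hK k hk
  rw [add_zero, Real.dist_eq, sub_zero] at hk
  rw [Real.dist_eq, sub_zero,
    abs_of_nonneg (Finset.expect_nonneg fun _ _ => abs_nonneg _)]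
  have h1 : ∫ x, l x ∂μ ≤ ∫ x, g x ∂μ := integral_mono_ae hli hgi (hμ.mono fun x hx => hlg x hx)
  have h2 : ∫ x, g x ∂μ ≤ ∫ x, u x ∂μ := integral_mono_ae hgi hui (hμ.mono fun x hx => hgu x hx)
  have key : 𝔼 ω, |(∑ i, g (lam k ω i)) / N k - ∫ x, g x ∂μ| ≤
      𝔼 ω, |(∑ i, l (lam k ω i)) / N k - ∫ x, l x ∂μ| +
        𝔼 ω, |(∑ i, u (lam k ω i)) / N k - ∫ x, u x ∂μ| + ε / 2 := by
    have := hΩ k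
    rw [← Fintype.expect_const (ι := Ω k) (ε / 2), ← Finset.expect_add_distrib,
      ← Finset.expect_add_distrib]
    refine Finset.expect_le_expect fun ω _ => ?_
    have h3 : (∑ i, l (lam k ω i)) / N k ≤ (∑ i, g (lam k ω i)) / N k :=
      div_le_div_of_nonneg_right (Finset.sum_le_sum fun i _ => hlg _ (hlam k ω i)) hNk.le
    have h4 : (∑ i, g (lam k ω i)) / N k ≤ (∑ i, u (lam k ω i)) / N k :=
      div_le_div_of_nonneg_right (Finset.sum_le_sum fun i _ => hgu _ (hlam k ω i)) hNk.le
    have h5 := neg_abs_le ((∑ i, l (lam k ω i)) / N k - ∫ x, l x ∂μ)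
    have h6 := le_abs_self ((∑ i, u (lam k ω i)) / N k - ∫ x, u x ∂μ)
    have h7 := abs_nonneg ((∑ i, l (lam k ω i)) / N k - ∫ x, l x ∂μ)
    have h8 := abs_nonneg ((∑ i, u (lam k ω i)) / N k - ∫ x, u x ∂μ)
    rw [abs_le]
    constructor <;> linarith
  linarith [le_abs_self (𝔼 ω, |(∑ i, l (lam k ω i)) / N k - ∫ x, l x ∂μ| +
        𝔼 ω, |(∑ i, u (lam k ω i)) / N k - ∫ x, u x ∂μ|)]

include hlam hN hΩ hμ in
theorem meanConverges_of_uniform_approx {g : ℝ → ℝ} (hgi : Integrable g μ)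
    (h : ∀ ε > 0, ∃ f : ℝ → ℝ, MeanConverges lam μ f ∧ Integrable f μ ∧
      ∀ x, 0 ≤ x → |f x - g x| ≤ ε) :
    MeanConverges lam μ g := by
  refine meanConverges_of_sandwich lam hlam hN hΩ μ hμ hgi fun ε hε => ?_
  obtain ⟨f, hf, hfi, hfg⟩ := h (ε / 2) (by positivity)
  refine ⟨fun x => f x + -(ε / 2), fun x => f x + ε / 2,
    hf.add (meanConverges_const lam hN μ _) hfi (integrable_const _),
    hf.add (meanConverges_const lam hN μ _) hfi (integrable_const _),
    hfi.add (integrable_const _), hfi.add (integrable_const _), fun x hx => ?_, fun x hx => ?_, ?_⟩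
  · linarith [(abs_le.1 (hfg x hx)).2]
  · linarith [(abs_le.1 (hfg x hx)).1]
  · rw [integral_add hfi (integrable_const _), integral_add hfi (integrable_const _)]
    simp only [integral_const, probReal_univ, one_smul]
    linarith

/-- Mean value bounds for the j-th power, multiplied by w and by u to avoid the exponent j − 1. -/
theorem mul_pow_mul_sub_le {w u : ℝ} (hw : 0 ≤ w) (hwu : w ≤ u) (j : ℕ) :
    j * w ^ j * (u - w) ≤ w * (u ^ j - w ^ j) ∧ u * (u ^ j - w ^ j) ≤ j * u ^ j * (u - w) := by
  have hu : 0 ≤ u := hw.trans hwu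
  have hd : 0 ≤ u - w := sub_nonneg.2 hwu
  induction j with
  | zero => simp
  | succ j ih =>
    obtain ⟨h1, h2⟩ := ih
    have h3 : w ^ j ≤ u ^ j := pow_le_pow_left₀ hw hwu j
    have h4 := mul_le_mul_of_nonneg_left h1 hu
    have h5 := mul_le_mul_of_nonneg_left h2 hu
    have h6 : 0 ≤ (j : ℝ) * w ^ j * (u - w) := by positivity
    have h7 := mul_le_mul_of_nonneg_right hwu h6
    have h8 := mul_le_mul_of_nonneg_left h3 (mul_nonneg hu hd)
    push_cast
    constructor
    · linear_combination h4 + h7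
    · linear_combination h5 + h8

/-- Since a⁻⁽ʲ⁺¹⁾ = −(1/j) d/da a⁻ʲ, a difference quotient approximates it with an O(δ) error,
uniform over a ≥ t. -/
theorem abs_diffQuotient_inv_pow_sub_le {a δ t : ℝ} (ht : 0 < t) (hta : t ≤ a) (hδ : 0 < δ)
    {j : ℕ} (hj : 0 < j) :
    |(j * δ)⁻¹ * (a⁻¹ ^ j - (a + δ)⁻¹ ^ j) - a⁻¹ ^ (j + 1)| ≤ δ * ((j + 1) * t⁻¹ ^ (j + 2)) := by
  have ha : 0 < a := ht.trans_le hta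
  set u := a⁻¹ with hu
  set w := (a + δ)⁻¹ with hw
  have hw0 : 0 < w := by positivity
  have hwu : w ≤ u := inv_anti₀ ha (by linarith)
  have hu0 : 0 < u := by positivity
  have huw : u - w = δ * (u * w) := by rw [hu, hw]; field_simp; ring
  have hut : u ≤ t⁻¹ := inv_anti₀ ht hta
  have hj' : (0 : ℝ) < j := by exact_mod_cast hj
  obtain ⟨h1, h2⟩ := mul_pow_mul_sub_le hw0.le hwu j
  have h3 := (mul_pow_mul_sub_le hw0.le hwu (j + 1)).2
  rw [huw] at h1 h2 h3
  have h4 : j * δ * w ^ (j + 1) ≤ u ^ j - w ^ j := by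
    have : w * (j * δ * w ^ j * u) ≤ w * (u ^ j - w ^ j) := by linear_combination h1
    have h := le_of_mul_le_mul_left this hw0
    refine le_trans ?_ h
    rw [pow_succ, ← mul_assoc]
    gcongr
  have h5 : u ^ j - w ^ j ≤ j * δ * u ^ (j + 1) := by
    have : u * (u ^ j - w ^ j) ≤ u * (j * δ * u ^ j * w) := by linear_combination h2
    have h := le_of_mul_le_mul_left this hu0
    refine h.trans ?_
    rw [pow_succ, ← mul_assoc]
    gcongr
  have h6 : u ^ (j + 1) - w ^ (j + 1) ≤ δ * ((j + 1) * t⁻¹ ^ (j + 2)) := by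
    have : u * (u ^ (j + 1) - w ^ (j + 1)) ≤ u * (δ * ((j + 1) * (u ^ (j + 1) * w))) := by
      push_cast at h3
      linear_combination h3
    refine (le_of_mul_le_mul_left this hu0).trans ?_
    rw [pow_succ _ (j + 1)]
    have := hwu.trans hut
    gcongr
  have h7 : w ^ (j + 1) ≤ (j * δ)⁻¹ * (u ^ j - w ^ j) := by
    rw [inv_mul_eq_div, le_div_iff₀ (by positivity)]; linarith
  have h8 : (j * δ)⁻¹ * (u ^ j - w ^ j) ≤ u ^ (j + 1) := by
    rw [inv_mul_eq_div, div_le_iff₀ (by positivity)]; linarith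
  rw [abs_le]
  constructor <;> linarith

include hμ in
theorem integrable_inv_add_pow {t : ℝ} (ht : 0 < t) (j : ℕ) :
    Integrable (fun x => (x + t)⁻¹ ^ j) μ := by
  refine Integrable.of_bound (by fun_prop) (t⁻¹ ^ j) (hμ.mono fun x hx => ?_)
  rw [Real.norm_eq_abs, abs_of_nonneg (by positivity)]
  gcongr
  linarith

include hlam hN hΩ hμ in
-- Induction on the power, for all t simultaneously: the difference quotient at t also uses the
-- shift t + δ. The choice δ = ε/C makes the error bound exactly ε.
theorem meanConverges_inv_add_pow
    (h : ∀ t > 0, MeanConverges lam μ fun x => (x + t)⁻¹) (j : ℕ) :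
    ∀ t > 0, MeanConverges lam μ fun x => (x + t)⁻¹ ^ (j + 1) := by
  induction j with
  | zero => simpa using h
  | succ j ih =>
    intro t ht
    refine meanConverges_of_uniform_approx lam hlam hN hΩ μ hμ
      (integrable_inv_add_pow μ hμ ht _) fun ε hε => ?_
    set C : ℝ := ((j + 1 : ℕ) + 1) * t⁻¹ ^ (j + 1 + 2) with hC
    have hC0 : 0 < C := by positivity
    have hδ : 0 < ε / C := by positivity
    refine ⟨fun x => ((j + 1 : ℕ) * (ε / C))⁻¹ *
      ((x + t)⁻¹ ^ (j + 1) + (-1) * (x + (t + ε / C))⁻¹ ^ (j + 1)), ?_, ?_, fun x hx => ?_⟩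
    · exact ((ih t ht).add ((ih _ (by positivity)).const_mul _) (integrable_inv_add_pow μ hμ ht _)
        ((integrable_inv_add_pow μ hμ (by positivity) _).const_mul _)).const_mul _
    · exact ((integrable_inv_add_pow μ hμ ht _).add
        ((integrable_inv_add_pow μ hμ (by positivity) _).const_mul _)).const_mul _
    · have := abs_diffQuotient_inv_pow_sub_le ht (by linarith : t ≤ x + t) hδ j.succ_pos
      rw [Nat.succ_eq_add_one, ← hC, div_mul_cancel₀ _ hC0.ne', add_assoc x] at this
      simpa only [neg_one_mul, ← sub_eq_add_neg] using this

include hμ in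
theorem integrable_comp_inv_add_one {φ : ℝ → ℝ} (hφ : Continuous φ) :
    Integrable (fun x => φ (x + 1)⁻¹) μ := by
  obtain ⟨C, hC⟩ := (isCompact_Icc (a := (0 : ℝ)) (b := 1)).exists_bound_of_continuousOn
    hφ.continuousOn
  refine Integrable.of_bound ?_ C (hμ.mono fun x hx => hC _ ⟨by positivity, ?_⟩)
  · exact (hφ.measurable.comp (by fun_prop)).aestronglyMeasurable
  · exact inv_le_one_of_one_le₀ (by linarith)

include hlam hN hΩ hμ in
theorem meanConverges_polynomial_comp_inv
    (h : ∀ t > 0, MeanConverges lam μ fun x => (x + t)⁻¹) (q : Polynomial ℝ) :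
    MeanConverges lam μ fun x => q.eval (x + 1)⁻¹ := by
  induction q using Polynomial.induction_on' with
  | add q₁ q₂ h₁ h₂ =>
    simp only [Polynomial.eval_add]
    exact h₁.add h₂ (integrable_comp_inv_add_one μ hμ q₁.continuous)
      (integrable_comp_inv_add_one μ hμ q₂.continuous)
  | monomial j c =>
    simp only [Polynomial.eval_monomial]
    refine MeanConverges.const_mul ?_ c
    cases j with
    | zero => simpa using meanConverges_const lam hN μ 1
    | succ j => exact meanConverges_inv_add_pow lam hlam hN hΩ μ hμ h j 1 one_pos

include hlam hN hΩ hμ in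
-- Weierstrass approximation on [0, 1], where (x + 1)⁻¹ lies for x ≥ 0.
theorem meanConverges_continuous_comp_inv
    (h : ∀ t > 0, MeanConverges lam μ fun x => (x + t)⁻¹) {φ : ℝ → ℝ} (hφ : Continuous φ) :
    MeanConverges lam μ fun x => φ (x + 1)⁻¹ := by
  refine meanConverges_of_uniform_approx lam hlam hN hΩ μ hμ
    (integrable_comp_inv_add_one μ hμ hφ) fun ε hε => ?_
  obtain ⟨q, hq⟩ := exists_polynomial_near_of_continuousOn 0 1 φ hφ.continuousOn ε hε
  refine ⟨_, meanConverges_polynomial_comp_inv lam hlam hN hΩ μ hμ h q,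
    integrable_comp_inv_add_one μ hμ q.continuous, fun x hx => (hq _ ⟨by positivity, ?_⟩).le⟩
  exact inv_le_one_of_one_le₀ (by linarith)

/-- The piecewise linear function that is `0` below `0` and `1` above `1`. -/
noncomputable def unitClamp (z : ℝ) : ℝ := max 0 (min 1 z)

theorem continuous_unitClamp : Continuous unitClamp := by
  unfold unitClamp; fun_prop

theorem unitClamp_of_nonpos {z : ℝ} (h : z ≤ 0) : unitClamp z = 0 :=
  max_eq_left ((min_le_right _ _).trans h)

theorem unitClamp_of_one_le {z : ℝ} (h : 1 ≤ z) : unitClamp z = 1 := by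
  rw [unitClamp, min_eq_left h, max_eq_right zero_le_one]

theorem unitClamp_nonneg (z : ℝ) : 0 ≤ unitClamp z := le_max_left _ _

theorem unitClamp_le_one (z : ℝ) : unitClamp z ≤ 1 := max_le zero_le_one (min_le_left _ _)

theorem tendsto_unitClamp_sub_unitClamp {d : ℝ} (hd : d ≠ 0) :
    Tendsto (fun j : ℕ => unitClamp (j * d + 1) - unitClamp (j * d)) atTop (𝓝 0) := by
  refine tendsto_const_nhds.congr' ?_
  obtain ⟨J, hJ⟩ := exists_nat_ge (1 / |d|)
  filter_upwards [eventually_ge_atTop J] with j hj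
  have h1 : 1 ≤ j * |d| := by
    rw [div_le_iff₀ (abs_pos.2 hd)] at hJ
    refine hJ.trans ?_
    gcongr
  rcases hd.lt_or_gt with h | h
  · rw [abs_of_neg h] at h1
    rw [unitClamp_of_nonpos (by linarith), unitClamp_of_nonpos (by linarith), sub_zero]
  · rw [abs_of_pos h] at h1
    rw [unitClamp_of_one_le (by linarith), unitClamp_of_one_le (by linarith), sub_self]

include hμ in
-- Dominated convergence: off z = x the two ramps eventually agree, and x carries no mass.
theorem tendsto_integral_unitClamp_sub {x : ℝ} (hatom : μ {x} = 0) :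
    Tendsto (fun j : ℕ => ∫ z, (unitClamp (j * ((z + 1)⁻¹ - (x + 1)⁻¹) + 1)
      - unitClamp (j * ((z + 1)⁻¹ - (x + 1)⁻¹))) ∂μ) atTop (𝓝 0) := by
  rw [← integral_zero ℝ ℝ (μ := μ)]
  refine tendsto_integral_of_dominated_convergence (fun _ => 1) (fun j => ?_)
    (integrable_const _) (fun j => Eventually.of_forall fun z => ?_) ?_
  · refine (Measurable.sub ?_ ?_).aestronglyMeasurable <;>
      exact continuous_unitClamp.measurable.comp (by fun_prop)
  · rw [Real.norm_eq_abs, abs_le]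
    have h1 := unitClamp_nonneg (j * ((z + 1)⁻¹ - (x + 1)⁻¹))
    have h2 := unitClamp_le_one (j * ((z + 1)⁻¹ - (x + 1)⁻¹))
    have h3 := unitClamp_nonneg (j * ((z + 1)⁻¹ - (x + 1)⁻¹) + 1)
    have h4 := unitClamp_le_one (j * ((z + 1)⁻¹ - (x + 1)⁻¹) + 1)
    constructor <;> linarith
  · have hne : ∀ᵐ z ∂μ, z ≠ x := by
      rw [ae_iff]; simpa using hatom
    filter_upwards [hμ, hne] with z hz hzx
    refine tendsto_unitClamp_sub_unitClamp (sub_ne_zero.2 fun h => hzx ?_)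
    linarith [inv_injective h]

include hlam hN hΩ hμ in
/-- Convergence in mean of the Stieltjes transforms on the negative half-line gives convergence in
mean of the cumulative distribution functions at points that are not atoms. -/
theorem meanConverges_indicator_Iic
    (h : ∀ t > 0, MeanConverges lam μ fun x => (x + t)⁻¹) (x : ℝ) (hatom : μ {x} = 0) :
    MeanConverges lam μ (Set.indicator (Set.Iic x) 1) := by
  have hgi : Integrable (Set.indicator (Set.Iic x) (1 : ℝ → ℝ)) μ :=
    (integrable_const (1 : ℝ)).indicator measurableSet_Iic
  refine meanConverges_of_sandwich lam hlam hN hΩ μ hμ hgi fun ε hε => ?_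
  rcases lt_or_ge x 0 with hx | hx
  · have h0 : ∀ z : ℝ, 0 ≤ z → Set.indicator (Set.Iic x) (1 : ℝ → ℝ) z = 0 := fun z hz =>
      Set.indicator_of_notMem (by simpa using hx.trans_le hz) _
    exact ⟨fun _ => 0, fun _ => 0, meanConverges_const lam hN μ 0, meanConverges_const lam hN μ 0,
      integrable_const _, integrable_const _, fun z hz => (h0 z hz).ge, fun z hz => (h0 z hz).le,
      by simpa using hε.le⟩
  -- For z ≥ 0, z ≤ x means (z + 1)⁻¹ ≥ (x + 1)⁻¹. Ramps of slope j in (z + 1)⁻¹, one starting and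
  -- one ending at that threshold, bracket the indicator.
  · obtain ⟨j, hj⟩ := ((tendsto_integral_unitClamp_sub μ hμ hatom).eventually
      (eventually_le_nhds hε)).exists
    have c1 : Continuous fun v : ℝ => unitClamp (j * (v - (x + 1)⁻¹)) :=
      continuous_unitClamp.comp (by fun_prop)
    have c2 : Continuous fun v : ℝ => unitClamp (j * (v - (x + 1)⁻¹) + 1) :=
      continuous_unitClamp.comp (by fun_prop)
    have i1 := integrable_comp_inv_add_one μ hμ c1
    have i2 := integrable_comp_inv_add_one μ hμ c2
    have m1 := meanConverges_continuous_comp_inv lam hlam hN hΩ μ hμ h c1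
    have m2 := meanConverges_continuous_comp_inv lam hlam hN hΩ μ hμ h c2
    refine ⟨fun z => unitClamp (j * ((z + 1)⁻¹ - (x + 1)⁻¹)),
      fun z => unitClamp (j * ((z + 1)⁻¹ - (x + 1)⁻¹) + 1), m1, m2, i1, i2, ?_, ?_, ?_⟩
    · intro z hz
      by_cases hzx : z ≤ x
      · rw [Set.indicator_of_mem (Set.mem_Iic.2 hzx)]
        exact unitClamp_le_one _
      · rw [Set.indicator_of_notMem (by simpa using hzx)]
        have : (z + 1)⁻¹ ≤ (x + 1)⁻¹ := inv_anti₀ (by linarith) (by linarith)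
        exact (unitClamp_of_nonpos (mul_nonpos_of_nonneg_of_nonpos (Nat.cast_nonneg j)
          (by linarith))).le
    · intro z hz
      by_cases hzx : z ≤ x
      · rw [Set.indicator_of_mem (Set.mem_Iic.2 hzx)]
        have h1 : (x + 1)⁻¹ ≤ (z + 1)⁻¹ := inv_anti₀ (by linarith) (by linarith)
        have h2 := mul_nonneg (Nat.cast_nonneg (α := ℝ) j) (sub_nonneg.2 h1)
        exact (unitClamp_of_one_le (by linarith)).ge
      · rw [Set.indicator_of_notMem (by simpa using hzx)]
        exact unitClamp_nonneg _
    · rwa [integral_sub i2 i1] at hj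

end MeanConvergence

/-! ### Markov's inequality and the conclusion -/

section Main

open scoped BigOperators

/-- Markov's inequality for the uniform distribution on a finite type. -/
theorem uniformOn_univ_ge_le_expect_div {Ω : Type*} [Fintype Ω] [MeasurableSpace Ω]
    [MeasurableSingletonClass Ω] {X : Ω → ℝ} (hX : ∀ ω, 0 ≤ X ω) {ε : ℝ} (hε : 0 < ε) :
    uniformOn Set.univ {ω | ε ≤ X ω} ≤ ENNReal.ofReal ((𝔼 ω, X ω) / ε) := by
  classical
  rcases isEmpty_or_nonempty Ω with h | h
  · simp [Set.eq_empty_of_isEmpty]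
  have hc : (0 : ℝ) < Fintype.card Ω := by exact_mod_cast Fintype.card_pos
  have hS : {ω | ε ≤ X ω} = ((Finset.univ.filter fun ω => ε ≤ X ω : Finset Ω) : Set Ω) := by
    ext; simp
  have hcard : ((Finset.univ.filter fun ω => ε ≤ X ω).card : ℝ) * ε ≤ ∑ ω, X ω := by
    rw [← nsmul_eq_mul]
    exact (Finset.card_nsmul_le_sum _ _ _ fun ω hω => (Finset.mem_filter.1 hω).2).trans
      (Finset.sum_le_univ_sum_of_nonneg hX)
  rw [uniformOn_univ, hS, Measure.count_apply_finset, ← ENNReal.ofReal_natCast,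
    ← ENNReal.ofReal_natCast, ← ENNReal.ofReal_div_of_pos hc]
  refine ENNReal.ofReal_le_ofReal ?_
  rw [Fintype.expect_eq_sum_div_card, div_div, div_le_div_iff₀ hc (by positivity)]
  nlinarith

theorem ae_nonneg_marchenkoPasturLaw {y : ℝ} (hy : y ∈ Set.Ioo (0 : ℝ) 1) :
    ∀ᵐ x ∂marchenkoPasturLaw y, 0 ≤ x := by
  rw [marchenkoPasturLaw, ae_withDensity_iff measurable_marchenkoPasturDensity.ennreal_ofReal]
  refine Eventually.of_forall fun x hx => ?_
  by_contra hneg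
  refine hx ?_
  rw [marchenkoPasturDensity, Set.indicator_of_notMem, ENNReal.ofReal_zero]
  exact fun h => hneg ((marchenkoPastur_edges hy).1.le.trans h.1)

theorem marchenkoPasturLaw_singleton (y x : ℝ) : marchenkoPasturLaw y {x} = 0 :=
  withDensity_absolutelyContinuous _ _ (measure_singleton x)

end Main

theorem theorem1 (y : ℝ) (hy : y ∈ Set.Ioo (0 : ℝ) 1)
    (n p m : ℕ → ℕ)
    (hn : Tendsto n atTop atTop)
    (hp : ∀ k, (p k : ℝ) / (n k : ℝ) = y)
    (hm : ∀ k, √(n k : ℝ) ≤ (m k : ℝ))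
    (B : ∀ k, Fin (m k) →
      OrthonormalBasis (Fin (n k)) ℂ (EuclideanSpace ℂ (Fin (n k))))
    (hB : ∀ k, MutuallyUnbiased (B k))
    (x ε : ℝ) (hε : 0 < ε) :
    Tendsto
      (fun k => selectionMeasure (p k) (m k) (n k)
        {s | ε ≤ |gramESD (rowMatrix (B k) s) x - marchenkoPasturCDF y x|})
      atTop (𝓝 0) := by
  have hy0 := hy.1
  -- Division by zero returns 0, so n = 0 would force y = 0.
  have hn0 : ∀ k, 0 < n k := fun k => Nat.pos_of_ne_zero fun h => by
    have := hp k
    simp [h] at this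
    linarith
  have hp0 : ∀ k, 0 < p k := fun k => Nat.pos_of_ne_zero fun h => by
    have := hp k
    simp [h] at this
    linarith
  have hm0 : ∀ k, 0 < m k := fun k => by
    have h1 : (0 : ℝ) < n k := by exact_mod_cast hn0 k
    exact_mod_cast (Real.sqrt_pos.2 h1).trans_le (hm k)
  have hΩ : ∀ k, Nonempty (Selection (p k) (m k) (n k)) := fun k =>
    ⟨fun _ => (⟨0, hm0 k⟩, ⟨0, hn0 k⟩)⟩
  have hnR : Tendsto (fun k => (n k : ℝ)) atTop atTop := tendsto_natCast_atTop_atTop.comp hn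
  have hmR : Tendsto (fun k => √(m k : ℝ)) atTop atTop :=
    Real.tendsto_sqrt_atTop.comp
      (tendsto_atTop_mono hm (Real.tendsto_sqrt_atTop.comp hnR))
  have := isProbabilityMeasure_marchenkoPasturLaw hy
  have hStieltjes : ∀ t > 0, MeanConverges
      (fun k (s : Selection (p k) (m k) (n k)) => gramEigenvalues (rowMatrix (B k) s))
      (marchenkoPasturLaw y) fun x => (x + t)⁻¹ := by
    intro t ht
    obtain ⟨hr, heq⟩ := marchenkoPastur_equation hy ht
    -- The terms (1 − y)/t of the two companion transforms cancel; y⁻¹ undoes the remaining factor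
    -- y.
    refine meanConverges_of_le
      (u := fun k => y⁻¹ * (t⁻¹ * (y * (t⁻¹ * (√(m k))⁻¹ + t⁻¹ * (n k : ℝ)⁻¹)))) ?_ fun k => ?_
    · have h1 := (hmR.inv_tendsto_atTop.const_mul t⁻¹).add (hnR.inv_tendsto_atTop.const_mul t⁻¹)
      simpa using ((h1.const_mul y).const_mul t⁻¹).const_mul y⁻¹
    · rw [← hp k] at heq hr
      have h := expect_abs_normalizedTrace_sub_le (hn0 k) (hm0 k) (B k) (hB k) ht hr heq
      simp only [normalizedTrace_eq_eigenvalueMean (hn0 k) (hp0 k) (B k) _ ht, hp k,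
        add_sub_add_left_eq_sub, ← mul_sub, abs_mul, abs_of_pos hy0, ← Finset.mul_expect] at h
      rw [inv_mul_eq_div, le_div_iff₀' hy0]
      simpa only [one_div, mul_inv, eigenvalueMean] using h
  have hcdf := meanConverges_indicator_Iic _ (fun k s i => gramEigenvalues_nonneg _ i) hp0 hΩ
    (marchenkoPasturLaw y) (ae_nonneg_marchenkoPasturLaw hy) hStieltjes x
    (marchenkoPasturLaw_singleton y x)
  have hint : ∫ z, Set.indicator (Set.Iic x) (1 : ℝ → ℝ) z ∂marchenkoPasturLaw y =
      marchenkoPasturCDF y x := integral_indicator_one measurableSet_Iic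
  rw [MeanConverges, hint] at hcdf
  have hbound := ENNReal.tendsto_ofReal (hcdf.div_const ε)
  rw [zero_div, ENNReal.ofReal_zero] at hbound
  refine tendsto_of_tendsto_of_tendsto_of_le_of_le tendsto_const_nhds hbound
    (fun _ => zero_le) fun k => ?_
  simp only [gramESD_eq]
  exact uniformOn_univ_ge_le_expect_div (fun _ => abs_nonneg _) hε
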